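/- Let MLTT be intensional Martin-Löf type theory: the dependent type theory with judgements $A$ set, $A=B$, $a\in A$, $a=b\in A$ in contexts, the usual rules for assumptions, equality, conversion and substitution, and the formation, introduction, elimination, computation and congruence rules for $\prod$ (with $\beta$, without extensionality), $\sum$, $+$, intensional identity sets $\mathsf{Id}$, finite enumeration sets $N_k$, natural numbers, lists, well-orderings $W$, and a universe $U$ of codes of small sets closed under these formers. Let $\mathbf{ML}$ be the category whose objects are the closed sets of MLTT, and whose arrows $A\to B$ are the equivalence classes $\lfloor t\in B\ [x\in A]\rfloor$ of derivable terms, where $t$ and $t'$ are equivalent if there is a proof-term $p\in\mathsf{Id}(B,t,t')\ [x\in A]$; identities are variables and composition is substitution. It has finite products, with terminal object $N_1$ and $A\times B=\sum_{x\in A}B$. Let $F^{ML}:\mathbf{ML}^{\mathrm{op}}\to\mathbf{InfSL}$ be the functor to the category of inf-semilattices (posets with all finite infs) which sends $A$ to the poset of predicates $\varphi\ \mathrm{prop}\ [x\in A]$ (propositions being identified with sets) up to equiprovability, with $\varphi\le\psi$ if there is a proof-term $r\in\psi\ [x\in A,w\in\varphi]$, and which sends an arrow $f$ to the substitution $F^{ML}_f$.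 In a category with finite products, a weak evaluation from $A$ to $B$ is an arrow $w:W\times A\to B$ such that for every $f:X\times A\to B$ there is a (not necessarily unique) $f':X\to W$ with $f=w\circ(f'\times\mathrm{id}_A)$; the category is weakly cartesian closed if there is a weak evaluation for each pair of objects. Proposition. (1) The category $\mathbf{ML}$ is weakly cartesian closed; for closed sets $A$ and $B$, the arrow $$\Big\lfloor \pi_1(z)(\pi_2(z))\in B\ \big[z\in(\textstyle\prod_{x\in A}B)\times A\big]\Big\rfloor:\ (\textstyle\prod_{x\in A}B)\times A\to B$$ is a weak evaluation from $A$ to $B$. (2) For every arrow $f:A\to B$ of $\mathbf{ML}$, the monotone map $F^{ML}_f:F^{ML}(B)\to F^{ML}(A)$ has a right adjoint $\forall_f$. These right adjoints satisfy the Beck–Chevalley condition: for every pullback square $f\circ h=g\circ k$ in $\mathbf{ML}$, with $h:P\to X$, $k:P\to Y$, $f:X\to Z$, $g:Y\to Z$, and every $\beta\in F^{ML}(X)$, one has $F^{ML}_g(\forall_f\,\beta)=\forall_k\,F^{ML}_h(\beta)$. -/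

import Mathlib

open CategoryTheory Limits MonoidalCategory CartesianMonoidalCategory Opposite

namespace MLTT

/-! ## Raw expressions -/

/-- De Bruijn variables in a context of length `n`; `z` is the most recently declared variable. -/
inductive Var : ℕ → Type
  | z {n : ℕ} : Var (n + 1)
  | s {n : ℕ} (i : Var n) : Var (n + 1)

/-- Expressions (for sets and for elements alike) with free variables among `n` declared ones.
An argument in `Tm (n + k)` binds `k` variables. -/
inductive Tm : ℕ → Type
  | var {n : ℕ} (i : Var n) : Tm n
  -- sets: dependent product, dependent sum, disjoint union, intensional identity,
  -- enumeration sets `N_k`, natural numbers, lists, well-orderings,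
  -- the set `U` of (codes of) small sets and the decoding `El`
  | Pi {n : ℕ} (A : Tm n) (B : Tm (n + 1)) : Tm n
  | Sig {n : ℕ} (A : Tm n) (B : Tm (n + 1)) : Tm n
  | Sum {n : ℕ} (A B : Tm n) : Tm n
  | Id {n : ℕ} (A a b : Tm n) : Tm n
  | Enum {n : ℕ} (k : ℕ) : Tm n
  | Nat {n : ℕ} : Tm n
  | List {n : ℕ} (A : Tm n) : Tm n
  | W {n : ℕ} (A : Tm n) (B : Tm (n + 1)) : Tm n
  | U {n : ℕ} : Tm n
  | El {n : ℕ} (a : Tm n) : Tm n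
  -- elements
  | lam {n : ℕ} (b : Tm (n + 1)) : Tm n
  | app {n : ℕ} (f a : Tm n) : Tm n
  | pair {n : ℕ} (a b : Tm n) : Tm n
  | split {n : ℕ} (c : Tm n) (d : Tm (n + 2)) : Tm n
  | inl {n : ℕ} (a : Tm n) : Tm n
  | inr {n : ℕ} (b : Tm n) : Tm n
  | when {n : ℕ} (c : Tm n) (d e : Tm (n + 1)) : Tm n
  | refl {n : ℕ} (a : Tm n) : Tm n
  | idpeel {n : ℕ} (c : Tm n) (d : Tm (n + 1)) : Tm n
  | elem {n : ℕ} (k : ℕ) (i : Fin k) : Tm n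
  | case {n : ℕ} (k : ℕ) (c : Tm n) (d : Fin k → Tm n) : Tm n
  | zero {n : ℕ} : Tm n
  | succ {n : ℕ} (a : Tm n) : Tm n
  | natrec {n : ℕ} (c d : Tm n) (e : Tm (n + 2)) : Tm n
  | nil {n : ℕ} : Tm n
  | cons {n : ℕ} (a l : Tm n) : Tm n
  | listrec {n : ℕ} (c d : Tm n) (e : Tm (n + 3)) : Tm n
  | sup {n : ℕ} (a b : Tm n) : Tm n
  | wrec {n : ℕ} (c : Tm n) (d : Tm (n + 3)) : Tm n
  -- codes of small sets
  | cPi {n : ℕ} (a : Tm n) (b : Tm (n + 1)) : Tm n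
  | cSig {n : ℕ} (a : Tm n) (b : Tm (n + 1)) : Tm n
  | cSum {n : ℕ} (a b : Tm n) : Tm n
  | cId {n : ℕ} (a x y : Tm n) : Tm n
  | cEnum {n : ℕ} (k : ℕ) : Tm n
  | cNat {n : ℕ} : Tm n
  | cList {n : ℕ} (a : Tm n) : Tm n
  | cW {n : ℕ} (a : Tm n) (b : Tm (n + 1)) : Tm n

/-- Extension of a renaming under a binder. -/
def Var.lift {m n : ℕ} (ρ : Var m → Var n) : Var (m + 1) → Var (n + 1)
  | .z => .z
  | .s i => .s (ρ i)

namespace Tm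

/-- Renaming of variables. -/
def ren {m : ℕ} : Tm m → ∀ {n : ℕ}, (Var m → Var n) → Tm n
  | var i, _, ρ => var (ρ i)
  | Pi A B, _, ρ => Pi (A.ren ρ) (B.ren (Var.lift ρ))
  | Sig A B, _, ρ => Sig (A.ren ρ) (B.ren (Var.lift ρ))
  | Sum A B, _, ρ => Sum (A.ren ρ) (B.ren ρ)
  | Id A a b, _, ρ => Id (A.ren ρ) (a.ren ρ) (b.ren ρ)
  | Enum k, _, _ => Enum k
  | Nat, _, _ => Nat
  | List A, _, ρ => List (A.ren ρ)
  | W A B, _, ρ => W (A.ren ρ) (B.ren (Var.lift ρ))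
  | U, _, _ => U
  | El a, _, ρ => El (a.ren ρ)
  | lam b, _, ρ => lam (b.ren (Var.lift ρ))
  | app f a, _, ρ => app (f.ren ρ) (a.ren ρ)
  | pair a b, _, ρ => pair (a.ren ρ) (b.ren ρ)
  | split c d, _, ρ => split (c.ren ρ) (d.ren (Var.lift (Var.lift ρ)))
  | inl a, _, ρ => inl (a.ren ρ)
  | inr a, _, ρ => inr (a.ren ρ)
  | when c d e, _, ρ => when (c.ren ρ) (d.ren (Var.lift ρ)) (e.ren (Var.lift ρ))
  | refl a, _, ρ => refl (a.ren ρ)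
  | idpeel c d, _, ρ => idpeel (c.ren ρ) (d.ren (Var.lift ρ))
  | elem k i, _, _ => elem k i
  | case k c d, _, ρ => case k (c.ren ρ) (fun i => (d i).ren ρ)
  | zero, _, _ => zero
  | succ a, _, ρ => succ (a.ren ρ)
  | natrec c d e, _, ρ => natrec (c.ren ρ) (d.ren ρ) (e.ren (Var.lift (Var.lift ρ)))
  | nil, _, _ => nil
  | cons a l, _, ρ => cons (a.ren ρ) (l.ren ρ)
  | listrec c d e, _, ρ =>
      listrec (c.ren ρ) (d.ren ρ) (e.ren (Var.lift (Var.lift (Var.lift ρ))))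
  | sup a b, _, ρ => sup (a.ren ρ) (b.ren ρ)
  | wrec c d, _, ρ => wrec (c.ren ρ) (d.ren (Var.lift (Var.lift (Var.lift ρ))))
  | cPi a b, _, ρ => cPi (a.ren ρ) (b.ren (Var.lift ρ))
  | cSig a b, _, ρ => cSig (a.ren ρ) (b.ren (Var.lift ρ))
  | cSum a b, _, ρ => cSum (a.ren ρ) (b.ren ρ)
  | cId a x y, _, ρ => cId (a.ren ρ) (x.ren ρ) (y.ren ρ)
  | cEnum k, _, _ => cEnum k
  | cNat, _, _ => cNat
  | cList a, _, ρ => cList (a.ren ρ)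
  | cW a b, _, ρ => cW (a.ren ρ) (b.ren (Var.lift ρ))

/-- Weakening by one fresh variable. -/
def wk {n : ℕ} (t : Tm n) : Tm (n + 1) := t.ren Var.s

/-- Extension of a substitution under a binder. -/
def up {m n : ℕ} (σ : Var m → Tm n) : Var (m + 1) → Tm (n + 1)
  | .z => var .z
  | .s i => (σ i).wk

/-- Simultaneous (capture avoiding) substitution. -/
def sub {m : ℕ} : Tm m → ∀ {n : ℕ}, (Var m → Tm n) → Tm n
  | var i, _, σ => σ i
  | Pi A B, _, σ => Pi (A.sub σ) (B.sub (up σ))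
  | Sig A B, _, σ => Sig (A.sub σ) (B.sub (up σ))
  | Sum A B, _, σ => Sum (A.sub σ) (B.sub σ)
  | Id A a b, _, σ => Id (A.sub σ) (a.sub σ) (b.sub σ)
  | Enum k, _, _ => Enum k
  | Nat, _, _ => Nat
  | List A, _, σ => List (A.sub σ)
  | W A B, _, σ => W (A.sub σ) (B.sub (up σ))
  | U, _, _ => U
  | El a, _, σ => El (a.sub σ)
  | lam b, _, σ => lam (b.sub (up σ))
  | app f a, _, σ => app (f.sub σ) (a.sub σ)
  | pair a b, _, σ => pair (a.sub σ) (b.sub σ)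
  | split c d, _, σ => split (c.sub σ) (d.sub (up (up σ)))
  | inl a, _, σ => inl (a.sub σ)
  | inr a, _, σ => inr (a.sub σ)
  | when c d e, _, σ => when (c.sub σ) (d.sub (up σ)) (e.sub (up σ))
  | refl a, _, σ => refl (a.sub σ)
  | idpeel c d, _, σ => idpeel (c.sub σ) (d.sub (up σ))
  | elem k i, _, _ => elem k i
  | case k c d, _, σ => case k (c.sub σ) (fun i => (d i).sub σ)
  | zero, _, _ => zero
  | succ a, _, σ => succ (a.sub σ)
  | natrec c d e, _, σ => natrec (c.sub σ) (d.sub σ) (e.sub (up (up σ)))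
  | nil, _, _ => nil
  | cons a l, _, σ => cons (a.sub σ) (l.sub σ)
  | listrec c d e, _, σ => listrec (c.sub σ) (d.sub σ) (e.sub (up (up (up σ))))
  | sup a b, _, σ => sup (a.sub σ) (b.sub σ)
  | wrec c d, _, σ => wrec (c.sub σ) (d.sub (up (up (up σ))))
  | cPi a b, _, σ => cPi (a.sub σ) (b.sub (up σ))
  | cSig a b, _, σ => cSig (a.sub σ) (b.sub (up σ))
  | cSum a b, _, σ => cSum (a.sub σ) (b.sub σ)
  | cId a x y, _, σ => cId (a.sub σ) (x.sub σ) (y.sub σ)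
  | cEnum k, _, _ => cEnum k
  | cNat, _, _ => cNat
  | cList a, _, σ => cList (a.sub σ)
  | cW a b, _, σ => cW (a.sub σ) (b.sub (up σ))

/-- The substitution `t` for the last variable, `σ` for the others. -/
def scons {m n : ℕ} (t : Tm n) (σ : Var m → Tm n) : Var (m + 1) → Tm n
  | .z => t
  | .s i => σ i

/-- `b(a)`: the expression `a` is put for the last variable of `b`. -/
def inst {n : ℕ} (b : Tm (n + 1)) (a : Tm n) : Tm n := b.sub (scons a var)

/-- Variables of a context seen in its extension by `k` further variables. -/
def shift {n : ℕ} : ∀ k : ℕ, Var n → Var (n + k)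
  | 0, i => i
  | k + 1, i => .s (shift k i)

/-- `C(t)` in a context extended by `k` further variables which may occur in `t`. -/
def instAt {n : ℕ} (k : ℕ) (C : Tm (n + 1)) (t : Tm (n + k)) : Tm (n + k) :=
  C.sub (scons t (fun i => var (shift k i)))

/-- The last of the declared variables. -/
def v0 {n : ℕ} : Tm (n + 1) := var .z
/-- The last but one of the declared variables. -/
def v1 {n : ℕ} : Tm (n + 2) := var (.s .z)
/-- The last but two of the declared variables. -/
def v2 {n : ℕ} : Tm (n + 3) := var (.s (.s .z))

end Tm

/-! ## Judgements and derivations -/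

/-- Raw contexts `x₁ ∈ A₁, …, xₙ ∈ Aₙ`. -/
inductive Ctx : ℕ → Type
  | nil : Ctx 0
  | snoc {n : ℕ} (Γ : Ctx n) (A : Tm n) : Ctx (n + 1)

/-- The set over which a variable of the context ranges, as an expression in the whole context. -/
def Ctx.get : ∀ {n : ℕ}, Ctx n → Var n → Tm n
  | _, .snoc _ A, .z => A.wk
  | _, .snoc Γ _, .s i => (Γ.get i).wk

/-- The forms of judgement made in a context: the context is well formed, `A set`, `A = B`,
`a ∈ A`, `a = b ∈ A`. -/
inductive Jdg : ℕ → Type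
  | ctx {n : ℕ} : Jdg n
  | set {n : ℕ} (A : Tm n) : Jdg n
  | eqSet {n : ℕ} (A B : Tm n) : Jdg n
  | mem {n : ℕ} (a A : Tm n) : Jdg n
  | eqMem {n : ℕ} (a b A : Tm n) : Jdg n

/-- Substitution in a judgement. -/
def Jdg.sub {m n : ℕ} (σ : Var m → Tm n) : Jdg m → Jdg n
  | .ctx => .ctx
  | .set A => .set (A.sub σ)
  | .eqSet A B => .eqSet (A.sub σ) (B.sub σ)
  | .mem a A => .mem (a.sub σ) (A.sub σ)
  | .eqMem a b A => .eqMem (a.sub σ) (b.sub σ) (A.sub σ)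

open Tm in
/-- `Der Γ J`: the judgement `J` is derivable in the context `Γ` in intensional Martin-Löf type
theory. -/
inductive Der : ∀ {n : ℕ}, Ctx n → Jdg n → Prop
  -- contexts and assumptions
  | ctx_nil : Der .nil .ctx
  | ctx_snoc {n : ℕ} {Γ : Ctx n} {A : Tm n} : Der Γ (.set A) → Der (Γ.snoc A) .ctx
  | assumption {n : ℕ} {Γ : Ctx n} (i : Var n) : Der Γ .ctx → Der Γ (.mem (var i) (Γ.get i))
  -- equality
  | set_refl {n : ℕ} {Γ : Ctx n} {A : Tm n} : Der Γ (.set A) → Der Γ (.eqSet A A)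
  | set_symm {n : ℕ} {Γ : Ctx n} {A B : Tm n} : Der Γ (.eqSet A B) → Der Γ (.eqSet B A)
  | set_trans {n : ℕ} {Γ : Ctx n} {A B C : Tm n} :
      Der Γ (.eqSet A B) → Der Γ (.eqSet B C) → Der Γ (.eqSet A C)
  | mem_refl {n : ℕ} {Γ : Ctx n} {a A : Tm n} : Der Γ (.mem a A) → Der Γ (.eqMem a a A)
  | mem_symm {n : ℕ} {Γ : Ctx n} {a b A : Tm n} : Der Γ (.eqMem a b A) → Der Γ (.eqMem b a A)
  | mem_trans {n : ℕ} {Γ : Ctx n} {a b c A : Tm n} :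
      Der Γ (.eqMem a b A) → Der Γ (.eqMem b c A) → Der Γ (.eqMem a c A)
  | conv {n : ℕ} {Γ : Ctx n} {a A B : Tm n} :
      Der Γ (.mem a A) → Der Γ (.eqSet A B) → Der Γ (.mem a B)
  | conv_eq {n : ℕ} {Γ : Ctx n} {a b A B : Tm n} :
      Der Γ (.eqMem a b A) → Der Γ (.eqSet A B) → Der Γ (.eqMem a b B)
  -- substitution
  | subst {m n : ℕ} {Γ : Ctx m} {Δ : Ctx n} {J : Jdg m} {σ : Var m → Tm n} :
      Der Γ J → Der Δ .ctx → (∀ i, Der Δ (.mem (σ i) ((Γ.get i).sub σ))) → Der Δ (J.sub σ)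
  | subst_set_eq {m n : ℕ} {Γ : Ctx m} {Δ : Ctx n} {A : Tm m} {σ τ : Var m → Tm n} :
      Der Γ (.set A) → Der Δ .ctx → (∀ i, Der Δ (.eqMem (σ i) (τ i) ((Γ.get i).sub σ))) →
      Der Δ (.eqSet (A.sub σ) (A.sub τ))
  | subst_mem_eq {m n : ℕ} {Γ : Ctx m} {Δ : Ctx n} {a A : Tm m} {σ τ : Var m → Tm n} :
      Der Γ (.mem a A) → Der Δ .ctx → (∀ i, Der Δ (.eqMem (σ i) (τ i) ((Γ.get i).sub σ))) →
      Der Δ (.eqMem (a.sub σ) (a.sub τ) (A.sub σ))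
  -- dependent product
  | pi_form {n : ℕ} {Γ : Ctx n} {A : Tm n} {B : Tm (n + 1)} :
      Der Γ (.set A) → Der (Γ.snoc A) (.set B) → Der Γ (.set (Pi A B))
  | pi_form_eq {n : ℕ} {Γ : Ctx n} {A A₁ : Tm n} {B B₁ : Tm (n + 1)} :
      Der Γ (.set A) → Der Γ (.eqSet A A₁) → Der (Γ.snoc A) (.eqSet B B₁) →
      Der Γ (.eqSet (Pi A B) (Pi A₁ B₁))
  | lam {n : ℕ} {Γ : Ctx n} {A : Tm n} {B b : Tm (n + 1)} :
      Der Γ (.set A) → Der (Γ.snoc A) (.mem b B) → Der Γ (.mem (lam b) (Pi A B))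
  | lam_eq {n : ℕ} {Γ : Ctx n} {A : Tm n} {B b b₁ : Tm (n + 1)} :
      Der Γ (.set A) → Der (Γ.snoc A) (.eqMem b b₁ B) →
      Der Γ (.eqMem (lam b) (lam b₁) (Pi A B))
  | app {n : ℕ} {Γ : Ctx n} {A f a : Tm n} {B : Tm (n + 1)} :
      Der (Γ.snoc A) (.set B) → Der Γ (.mem f (Pi A B)) → Der Γ (.mem a A) →
      Der Γ (.mem (app f a) (B.inst a))
  | app_eq {n : ℕ} {Γ : Ctx n} {A f f₁ a a₁ : Tm n} {B : Tm (n + 1)} :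
      Der (Γ.snoc A) (.set B) → Der Γ (.eqMem f f₁ (Pi A B)) → Der Γ (.eqMem a a₁ A) →
      Der Γ (.eqMem (app f a) (app f₁ a₁) (B.inst a))
  | app_lam {n : ℕ} {Γ : Ctx n} {A a : Tm n} {B b : Tm (n + 1)} :
      Der (Γ.snoc A) (.mem b B) → Der Γ (.mem a A) →
      Der Γ (.eqMem (app (lam b) a) (b.inst a) (B.inst a))
  -- dependent sum
  | sig_form {n : ℕ} {Γ : Ctx n} {A : Tm n} {B : Tm (n + 1)} :
      Der Γ (.set A) → Der (Γ.snoc A) (.set B) → Der Γ (.set (Sig A B))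
  | sig_form_eq {n : ℕ} {Γ : Ctx n} {A A₁ : Tm n} {B B₁ : Tm (n + 1)} :
      Der Γ (.set A) → Der Γ (.eqSet A A₁) → Der (Γ.snoc A) (.eqSet B B₁) →
      Der Γ (.eqSet (Sig A B) (Sig A₁ B₁))
  | pair {n : ℕ} {Γ : Ctx n} {A a b : Tm n} {B : Tm (n + 1)} :
      Der (Γ.snoc A) (.set B) → Der Γ (.mem a A) → Der Γ (.mem b (B.inst a)) →
      Der Γ (.mem (pair a b) (Sig A B))
  | pair_eq {n : ℕ} {Γ : Ctx n} {A a a₁ b b₁ : Tm n} {B : Tm (n + 1)} :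
      Der (Γ.snoc A) (.set B) → Der Γ (.eqMem a a₁ A) → Der Γ (.eqMem b b₁ (B.inst a)) →
      Der Γ (.eqMem (pair a b) (pair a₁ b₁) (Sig A B))
  | split {n : ℕ} {Γ : Ctx n} {A c : Tm n} {B C : Tm (n + 1)} {d : Tm (n + 2)} :
      Der (Γ.snoc (Sig A B)) (.set C) → Der Γ (.mem c (Sig A B)) →
      Der ((Γ.snoc A).snoc B) (.mem d (C.instAt 2 (pair v1 v0))) →
      Der Γ (.mem (split c d) (C.inst c))
  | split_eq {n : ℕ} {Γ : Ctx n} {A c c₁ : Tm n} {B C : Tm (n + 1)} {d d₁ : Tm (n + 2)} :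
      Der (Γ.snoc (Sig A B)) (.set C) → Der Γ (.eqMem c c₁ (Sig A B)) →
      Der ((Γ.snoc A).snoc B) (.eqMem d d₁ (C.instAt 2 (pair v1 v0))) →
      Der Γ (.eqMem (split c d) (split c₁ d₁) (C.inst c))
  | split_pair {n : ℕ} {Γ : Ctx n} {A a b : Tm n} {B C : Tm (n + 1)} {d : Tm (n + 2)} :
      Der (Γ.snoc (Sig A B)) (.set C) → Der Γ (.mem a A) → Der Γ (.mem b (B.inst a)) →
      Der ((Γ.snoc A).snoc B) (.mem d (C.instAt 2 (pair v1 v0))) →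
      Der Γ (.eqMem (split (pair a b) d) (d.sub (scons b (scons a var))) (C.inst (pair a b)))
  -- disjoint union
  | sum_form {n : ℕ} {Γ : Ctx n} {A B : Tm n} :
      Der Γ (.set A) → Der Γ (.set B) → Der Γ (.set (Sum A B))
  | sum_form_eq {n : ℕ} {Γ : Ctx n} {A A₁ B B₁ : Tm n} :
      Der Γ (.eqSet A A₁) → Der Γ (.eqSet B B₁) → Der Γ (.eqSet (Sum A B) (Sum A₁ B₁))
  | inl {n : ℕ} {Γ : Ctx n} {A B a : Tm n} :
      Der Γ (.set B) → Der Γ (.mem a A) → Der Γ (.mem (inl a) (Sum A B))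
  | inl_eq {n : ℕ} {Γ : Ctx n} {A B a a₁ : Tm n} :
      Der Γ (.set B) → Der Γ (.eqMem a a₁ A) → Der Γ (.eqMem (inl a) (inl a₁) (Sum A B))
  | inr {n : ℕ} {Γ : Ctx n} {A B b : Tm n} :
      Der Γ (.set A) → Der Γ (.mem b B) → Der Γ (.mem (inr b) (Sum A B))
  | inr_eq {n : ℕ} {Γ : Ctx n} {A B b b₁ : Tm n} :
      Der Γ (.set A) → Der Γ (.eqMem b b₁ B) → Der Γ (.eqMem (inr b) (inr b₁) (Sum A B))
  | when {n : ℕ} {Γ : Ctx n} {A B c : Tm n} {C d e : Tm (n + 1)} :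
      Der (Γ.snoc (Sum A B)) (.set C) → Der Γ (.mem c (Sum A B)) →
      Der (Γ.snoc A) (.mem d (C.instAt 1 (inl v0))) →
      Der (Γ.snoc B) (.mem e (C.instAt 1 (inr v0))) →
      Der Γ (.mem (when c d e) (C.inst c))
  | when_eq {n : ℕ} {Γ : Ctx n} {A B c c₁ : Tm n} {C d d₁ e e₁ : Tm (n + 1)} :
      Der (Γ.snoc (Sum A B)) (.set C) → Der Γ (.eqMem c c₁ (Sum A B)) →
      Der (Γ.snoc A) (.eqMem d d₁ (C.instAt 1 (inl v0))) →
      Der (Γ.snoc B) (.eqMem e e₁ (C.instAt 1 (inr v0))) →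
      Der Γ (.eqMem (when c d e) (when c₁ d₁ e₁) (C.inst c))
  | when_inl {n : ℕ} {Γ : Ctx n} {A B a : Tm n} {C d e : Tm (n + 1)} :
      Der (Γ.snoc (Sum A B)) (.set C) → Der Γ (.mem a A) →
      Der (Γ.snoc A) (.mem d (C.instAt 1 (inl v0))) →
      Der (Γ.snoc B) (.mem e (C.instAt 1 (inr v0))) →
      Der Γ (.eqMem (when (inl a) d e) (d.inst a) (C.inst (inl a)))
  | when_inr {n : ℕ} {Γ : Ctx n} {A B b : Tm n} {C d e : Tm (n + 1)} :
      Der (Γ.snoc (Sum A B)) (.set C) → Der Γ (.mem b B) →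
      Der (Γ.snoc A) (.mem d (C.instAt 1 (inl v0))) →
      Der (Γ.snoc B) (.mem e (C.instAt 1 (inr v0))) →
      Der Γ (.eqMem (when (inr b) d e) (e.inst b) (C.inst (inr b)))
  -- intensional identity
  | id_form {n : ℕ} {Γ : Ctx n} {A a b : Tm n} :
      Der Γ (.set A) → Der Γ (.mem a A) → Der Γ (.mem b A) → Der Γ (.set (Id A a b))
  | id_form_eq {n : ℕ} {Γ : Ctx n} {A A₁ a a₁ b b₁ : Tm n} :
      Der Γ (.eqSet A A₁) → Der Γ (.eqMem a a₁ A) → Der Γ (.eqMem b b₁ A) →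
      Der Γ (.eqSet (Id A a b) (Id A₁ a₁ b₁))
  | refl {n : ℕ} {Γ : Ctx n} {A a : Tm n} :
      Der Γ (.mem a A) → Der Γ (.mem (refl a) (Id A a a))
  | refl_eq {n : ℕ} {Γ : Ctx n} {A a a₁ : Tm n} :
      Der Γ (.eqMem a a₁ A) → Der Γ (.eqMem (refl a) (refl a₁) (Id A a a))
  | idpeel {n : ℕ} {Γ : Ctx n} {A a b c : Tm n} {C : Tm (n + 3)} {d : Tm (n + 1)} :
      Der (((Γ.snoc A).snoc A.wk).snoc (Id A.wk.wk v1 v0)) (.set C) →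
      Der Γ (.mem a A) → Der Γ (.mem b A) → Der Γ (.mem c (Id A a b)) →
      Der (Γ.snoc A) (.mem d (C.sub (scons (refl v0) (scons v0 var)))) →
      Der Γ (.mem (idpeel c d) (C.sub (scons c (scons b (scons a var)))))
  | idpeel_eq {n : ℕ} {Γ : Ctx n} {A a a₁ b b₁ c c₁ : Tm n} {C : Tm (n + 3)}
      {d d₁ : Tm (n + 1)} :
      Der (((Γ.snoc A).snoc A.wk).snoc (Id A.wk.wk v1 v0)) (.set C) →
      Der Γ (.eqMem a a₁ A) → Der Γ (.eqMem b b₁ A) → Der Γ (.eqMem c c₁ (Id A a b)) →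
      Der (Γ.snoc A) (.eqMem d d₁ (C.sub (scons (refl v0) (scons v0 var)))) →
      Der Γ (.eqMem (idpeel c d) (idpeel c₁ d₁) (C.sub (scons c (scons b (scons a var)))))
  | idpeel_refl {n : ℕ} {Γ : Ctx n} {A a : Tm n} {C : Tm (n + 3)} {d : Tm (n + 1)} :
      Der (((Γ.snoc A).snoc A.wk).snoc (Id A.wk.wk v1 v0)) (.set C) → Der Γ (.mem a A) →
      Der (Γ.snoc A) (.mem d (C.sub (scons (refl v0) (scons v0 var)))) →
      Der Γ (.eqMem (idpeel (refl a) d) (d.inst a)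
        (C.sub (scons (refl a) (scons a (scons a var)))))
  -- enumeration sets
  | enum_form {n : ℕ} {Γ : Ctx n} (k : ℕ) : Der Γ .ctx → Der Γ (.set (Enum k))
  | elem {n : ℕ} {Γ : Ctx n} {k : ℕ} (i : Fin k) :
      Der Γ .ctx → Der Γ (.mem (elem k i) (Enum k))
  | case {n : ℕ} {Γ : Ctx n} {k : ℕ} {c : Tm n} {C : Tm (n + 1)} {d : Fin k → Tm n} :
      Der (Γ.snoc (Enum k)) (.set C) → Der Γ (.mem c (Enum k)) →
      (∀ i, Der Γ (.mem (d i) (C.inst (elem k i)))) →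
      Der Γ (.mem (case k c d) (C.inst c))
  | case_eq {n : ℕ} {Γ : Ctx n} {k : ℕ} {c c₁ : Tm n} {C : Tm (n + 1)} {d d₁ : Fin k → Tm n} :
      Der (Γ.snoc (Enum k)) (.set C) → Der Γ (.eqMem c c₁ (Enum k)) →
      (∀ i, Der Γ (.eqMem (d i) (d₁ i) (C.inst (elem k i)))) →
      Der Γ (.eqMem (case k c d) (case k c₁ d₁) (C.inst c))
  | case_elem {n : ℕ} {Γ : Ctx n} {k : ℕ} {C : Tm (n + 1)} {d : Fin k → Tm n} (i : Fin k) :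
      Der (Γ.snoc (Enum k)) (.set C) → (∀ i, Der Γ (.mem (d i) (C.inst (elem k i)))) →
      Der Γ (.eqMem (case k (elem k i) d) (d i) (C.inst (elem k i)))
  -- natural numbers
  | nat_form {n : ℕ} {Γ : Ctx n} : Der Γ .ctx → Der Γ (.set Nat)
  | zero {n : ℕ} {Γ : Ctx n} : Der Γ .ctx → Der Γ (.mem zero Nat)
  | succ {n : ℕ} {Γ : Ctx n} {a : Tm n} : Der Γ (.mem a Nat) → Der Γ (.mem (succ a) Nat)
  | succ_eq {n : ℕ} {Γ : Ctx n} {a a₁ : Tm n} :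
      Der Γ (.eqMem a a₁ Nat) → Der Γ (.eqMem (succ a) (succ a₁) Nat)
  | natrec {n : ℕ} {Γ : Ctx n} {c d : Tm n} {C : Tm (n + 1)} {e : Tm (n + 2)} :
      Der (Γ.snoc Nat) (.set C) → Der Γ (.mem c Nat) → Der Γ (.mem d (C.inst zero)) →
      Der ((Γ.snoc Nat).snoc C) (.mem e (C.instAt 2 (succ v1))) →
      Der Γ (.mem (natrec c d e) (C.inst c))
  | natrec_eq {n : ℕ} {Γ : Ctx n} {c c₁ d d₁ : Tm n} {C : Tm (n + 1)} {e e₁ : Tm (n + 2)} :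
      Der (Γ.snoc Nat) (.set C) → Der Γ (.eqMem c c₁ Nat) →
      Der Γ (.eqMem d d₁ (C.inst zero)) →
      Der ((Γ.snoc Nat).snoc C) (.eqMem e e₁ (C.instAt 2 (succ v1))) →
      Der Γ (.eqMem (natrec c d e) (natrec c₁ d₁ e₁) (C.inst c))
  | natrec_zero {n : ℕ} {Γ : Ctx n} {d : Tm n} {C : Tm (n + 1)} {e : Tm (n + 2)} :
      Der (Γ.snoc Nat) (.set C) → Der Γ (.mem d (C.inst zero)) →
      Der ((Γ.snoc Nat).snoc C) (.mem e (C.instAt 2 (succ v1))) →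
      Der Γ (.eqMem (natrec zero d e) d (C.inst zero))
  | natrec_succ {n : ℕ} {Γ : Ctx n} {c d : Tm n} {C : Tm (n + 1)} {e : Tm (n + 2)} :
      Der (Γ.snoc Nat) (.set C) → Der Γ (.mem c Nat) → Der Γ (.mem d (C.inst zero)) →
      Der ((Γ.snoc Nat).snoc C) (.mem e (C.instAt 2 (succ v1))) →
      Der Γ (.eqMem (natrec (succ c) d e) (e.sub (scons (natrec c d e) (scons c var)))
        (C.inst (succ c)))
  -- lists
  | list_form {n : ℕ} {Γ : Ctx n} {A : Tm n} : Der Γ (.set A) → Der Γ (.set (List A))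
  | list_form_eq {n : ℕ} {Γ : Ctx n} {A A₁ : Tm n} :
      Der Γ (.eqSet A A₁) → Der Γ (.eqSet (List A) (List A₁))
  | nil {n : ℕ} {Γ : Ctx n} {A : Tm n} : Der Γ (.set A) → Der Γ (.mem nil (List A))
  | cons {n : ℕ} {Γ : Ctx n} {A a l : Tm n} :
      Der Γ (.mem a A) → Der Γ (.mem l (List A)) → Der Γ (.mem (cons a l) (List A))
  | cons_eq {n : ℕ} {Γ : Ctx n} {A a a₁ l l₁ : Tm n} :
      Der Γ (.eqMem a a₁ A) → Der Γ (.eqMem l l₁ (List A)) →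
      Der Γ (.eqMem (cons a l) (cons a₁ l₁) (List A))
  | listrec {n : ℕ} {Γ : Ctx n} {A c d : Tm n} {C : Tm (n + 1)} {e : Tm (n + 3)} :
      Der (Γ.snoc (List A)) (.set C) → Der Γ (.mem c (List A)) → Der Γ (.mem d (C.inst nil)) →
      Der (((Γ.snoc A).snoc (List A.wk)).snoc (C.instAt 2 v0))
        (.mem e (C.instAt 3 (cons v2 v1))) →
      Der Γ (.mem (listrec c d e) (C.inst c))
  | listrec_eq {n : ℕ} {Γ : Ctx n} {A c c₁ d d₁ : Tm n} {C : Tm (n + 1)} {e e₁ : Tm (n + 3)} :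
      Der (Γ.snoc (List A)) (.set C) → Der Γ (.eqMem c c₁ (List A)) →
      Der Γ (.eqMem d d₁ (C.inst nil)) →
      Der (((Γ.snoc A).snoc (List A.wk)).snoc (C.instAt 2 v0))
        (.eqMem e e₁ (C.instAt 3 (cons v2 v1))) →
      Der Γ (.eqMem (listrec c d e) (listrec c₁ d₁ e₁) (C.inst c))
  | listrec_nil {n : ℕ} {Γ : Ctx n} {A d : Tm n} {C : Tm (n + 1)} {e : Tm (n + 3)} :
      Der (Γ.snoc (List A)) (.set C) → Der Γ (.mem d (C.inst nil)) →
      Der (((Γ.snoc A).snoc (List A.wk)).snoc (C.instAt 2 v0))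
        (.mem e (C.instAt 3 (cons v2 v1))) →
      Der Γ (.eqMem (listrec nil d e) d (C.inst nil))
  | listrec_cons {n : ℕ} {Γ : Ctx n} {A a l d : Tm n} {C : Tm (n + 1)} {e : Tm (n + 3)} :
      Der (Γ.snoc (List A)) (.set C) → Der Γ (.mem a A) → Der Γ (.mem l (List A)) →
      Der Γ (.mem d (C.inst nil)) →
      Der (((Γ.snoc A).snoc (List A.wk)).snoc (C.instAt 2 v0))
        (.mem e (C.instAt 3 (cons v2 v1))) →
      Der Γ (.eqMem (listrec (cons a l) d e)
        (e.sub (scons (listrec l d e) (scons l (scons a var)))) (C.inst (cons a l)))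
  -- well-orderings
  | w_form {n : ℕ} {Γ : Ctx n} {A : Tm n} {B : Tm (n + 1)} :
      Der Γ (.set A) → Der (Γ.snoc A) (.set B) → Der Γ (.set (W A B))
  | w_form_eq {n : ℕ} {Γ : Ctx n} {A A₁ : Tm n} {B B₁ : Tm (n + 1)} :
      Der Γ (.set A) → Der Γ (.eqSet A A₁) → Der (Γ.snoc A) (.eqSet B B₁) →
      Der Γ (.eqSet (W A B) (W A₁ B₁))
  | sup {n : ℕ} {Γ : Ctx n} {A a b : Tm n} {B : Tm (n + 1)} :
      Der (Γ.snoc A) (.set B) → Der Γ (.mem a A) →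
      Der Γ (.mem b (Pi (B.inst a) (W A B).wk)) → Der Γ (.mem (sup a b) (W A B))
  | sup_eq {n : ℕ} {Γ : Ctx n} {A a a₁ b b₁ : Tm n} {B : Tm (n + 1)} :
      Der (Γ.snoc A) (.set B) → Der Γ (.eqMem a a₁ A) →
      Der Γ (.eqMem b b₁ (Pi (B.inst a) (W A B).wk)) →
      Der Γ (.eqMem (sup a b) (sup a₁ b₁) (W A B))
  | wrec {n : ℕ} {Γ : Ctx n} {A c : Tm n} {B C : Tm (n + 1)} {d : Tm (n + 3)} :
      Der (Γ.snoc (W A B)) (.set C) → Der Γ (.mem c (W A B)) →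
      Der (((Γ.snoc A).snoc (Pi B (W A B).wk.wk)).snoc (Pi B.wk (C.instAt 3 (app v1 v0))))
        (.mem d (C.instAt 3 (sup v2 v1))) →
      Der Γ (.mem (wrec c d) (C.inst c))
  | wrec_eq {n : ℕ} {Γ : Ctx n} {A c c₁ : Tm n} {B C : Tm (n + 1)} {d d₁ : Tm (n + 3)} :
      Der (Γ.snoc (W A B)) (.set C) → Der Γ (.eqMem c c₁ (W A B)) →
      Der (((Γ.snoc A).snoc (Pi B (W A B).wk.wk)).snoc (Pi B.wk (C.instAt 3 (app v1 v0))))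
        (.eqMem d d₁ (C.instAt 3 (sup v2 v1))) →
      Der Γ (.eqMem (wrec c d) (wrec c₁ d₁) (C.inst c))
  | wrec_sup {n : ℕ} {Γ : Ctx n} {A a b : Tm n} {B C : Tm (n + 1)} {d : Tm (n + 3)} :
      Der (Γ.snoc (W A B)) (.set C) → Der Γ (.mem a A) →
      Der Γ (.mem b (Pi (B.inst a) (W A B).wk)) →
      Der (((Γ.snoc A).snoc (Pi B (W A B).wk.wk)).snoc (Pi B.wk (C.instAt 3 (app v1 v0))))
        (.mem d (C.instAt 3 (sup v2 v1))) →
      Der Γ (.eqMem (wrec (sup a b) d)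
        (d.sub (scons (lam (wrec (app b.wk v0) (d.ren (Var.lift (Var.lift (Var.lift Var.s))))))
          (scons b (scons a var))))
        (C.inst (sup a b)))
  -- the set of small sets
  | u_form {n : ℕ} {Γ : Ctx n} : Der Γ .ctx → Der Γ (.set U)
  | el_form {n : ℕ} {Γ : Ctx n} {a : Tm n} : Der Γ (.mem a U) → Der Γ (.set (El a))
  | el_form_eq {n : ℕ} {Γ : Ctx n} {a a₁ : Tm n} :
      Der Γ (.eqMem a a₁ U) → Der Γ (.eqSet (El a) (El a₁))
  | cPi {n : ℕ} {Γ : Ctx n} {a : Tm n} {b : Tm (n + 1)} :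
      Der Γ (.mem a U) → Der (Γ.snoc (El a)) (.mem b U) → Der Γ (.mem (cPi a b) U)
  | cPi_eq {n : ℕ} {Γ : Ctx n} {a a₁ : Tm n} {b b₁ : Tm (n + 1)} :
      Der Γ (.mem a U) → Der Γ (.eqMem a a₁ U) → Der (Γ.snoc (El a)) (.eqMem b b₁ U) →
      Der Γ (.eqMem (cPi a b) (cPi a₁ b₁) U)
  | el_cPi {n : ℕ} {Γ : Ctx n} {a : Tm n} {b : Tm (n + 1)} :
      Der Γ (.mem a U) → Der (Γ.snoc (El a)) (.mem b U) →
      Der Γ (.eqSet (El (cPi a b)) (Pi (El a) (El b)))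
  | cSig {n : ℕ} {Γ : Ctx n} {a : Tm n} {b : Tm (n + 1)} :
      Der Γ (.mem a U) → Der (Γ.snoc (El a)) (.mem b U) → Der Γ (.mem (cSig a b) U)
  | cSig_eq {n : ℕ} {Γ : Ctx n} {a a₁ : Tm n} {b b₁ : Tm (n + 1)} :
      Der Γ (.mem a U) → Der Γ (.eqMem a a₁ U) → Der (Γ.snoc (El a)) (.eqMem b b₁ U) →
      Der Γ (.eqMem (cSig a b) (cSig a₁ b₁) U)
  | el_cSig {n : ℕ} {Γ : Ctx n} {a : Tm n} {b : Tm (n + 1)} :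
      Der Γ (.mem a U) → Der (Γ.snoc (El a)) (.mem b U) →
      Der Γ (.eqSet (El (cSig a b)) (Sig (El a) (El b)))
  | cSum {n : ℕ} {Γ : Ctx n} {a b : Tm n} :
      Der Γ (.mem a U) → Der Γ (.mem b U) → Der Γ (.mem (cSum a b) U)
  | cSum_eq {n : ℕ} {Γ : Ctx n} {a a₁ b b₁ : Tm n} :
      Der Γ (.eqMem a a₁ U) → Der Γ (.eqMem b b₁ U) → Der Γ (.eqMem (cSum a b) (cSum a₁ b₁) U)
  | el_cSum {n : ℕ} {Γ : Ctx n} {a b : Tm n} :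
      Der Γ (.mem a U) → Der Γ (.mem b U) →
      Der Γ (.eqSet (El (cSum a b)) (Sum (El a) (El b)))
  | cId {n : ℕ} {Γ : Ctx n} {a x y : Tm n} :
      Der Γ (.mem a U) → Der Γ (.mem x (El a)) → Der Γ (.mem y (El a)) →
      Der Γ (.mem (cId a x y) U)
  | cId_eq {n : ℕ} {Γ : Ctx n} {a a₁ x x₁ y y₁ : Tm n} :
      Der Γ (.eqMem a a₁ U) → Der Γ (.eqMem x x₁ (El a)) → Der Γ (.eqMem y y₁ (El a)) →
      Der Γ (.eqMem (cId a x y) (cId a₁ x₁ y₁) U)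
  | el_cId {n : ℕ} {Γ : Ctx n} {a x y : Tm n} :
      Der Γ (.mem a U) → Der Γ (.mem x (El a)) → Der Γ (.mem y (El a)) →
      Der Γ (.eqSet (El (cId a x y)) (Id (El a) x y))
  | cEnum {n : ℕ} {Γ : Ctx n} (k : ℕ) : Der Γ .ctx → Der Γ (.mem (cEnum k) U)
  | el_cEnum {n : ℕ} {Γ : Ctx n} (k : ℕ) : Der Γ .ctx → Der Γ (.eqSet (El (cEnum k)) (Enum k))
  | cNat {n : ℕ} {Γ : Ctx n} : Der Γ .ctx → Der Γ (.mem cNat U)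
  | el_cNat {n : ℕ} {Γ : Ctx n} : Der Γ .ctx → Der Γ (.eqSet (El cNat) Nat)
  | cList {n : ℕ} {Γ : Ctx n} {a : Tm n} : Der Γ (.mem a U) → Der Γ (.mem (cList a) U)
  | cList_eq {n : ℕ} {Γ : Ctx n} {a a₁ : Tm n} :
      Der Γ (.eqMem a a₁ U) → Der Γ (.eqMem (cList a) (cList a₁) U)
  | el_cList {n : ℕ} {Γ : Ctx n} {a : Tm n} :
      Der Γ (.mem a U) → Der Γ (.eqSet (El (cList a)) (List (El a)))
  | cW {n : ℕ} {Γ : Ctx n} {a : Tm n} {b : Tm (n + 1)} :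
      Der Γ (.mem a U) → Der (Γ.snoc (El a)) (.mem b U) → Der Γ (.mem (cW a b) U)
  | cW_eq {n : ℕ} {Γ : Ctx n} {a a₁ : Tm n} {b b₁ : Tm (n + 1)} :
      Der Γ (.mem a U) → Der Γ (.eqMem a a₁ U) → Der (Γ.snoc (El a)) (.eqMem b b₁ U) →
      Der Γ (.eqMem (cW a b) (cW a₁ b₁) U)
  | el_cW {n : ℕ} {Γ : Ctx n} {a : Tm n} {b : Tm (n + 1)} :
      Der Γ (.mem a U) → Der (Γ.snoc (El a)) (.mem b U) →
      Der Γ (.eqSet (El (cW a b)) (W (El a) (El b)))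

/-! ## The substitution calculus -/

namespace Tm

theorem lift_comp {l m n : ℕ} (ρ : Var l → Var m) (τ : Var m → Var n) :
    (fun i => Var.lift τ (Var.lift ρ i)) = Var.lift (fun i => τ (ρ i)) := by
  funext i; cases i <;> rfl

theorem ren_ren {l : ℕ} (t : Tm l) : ∀ {m n : ℕ} (ρ : Var l → Var m) (τ : Var m → Var n),
    (t.ren ρ).ren τ = t.ren (fun i => τ (ρ i)) := by
  induction t <;> intros <;> simp only [ren, lift_comp, *]

theorem up_lift {l m n : ℕ} (ρ : Var l → Var m) (σ : Var m → Tm n) :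
    (fun i => up σ (Var.lift ρ i)) = up (fun i => σ (ρ i)) := by
  funext i; cases i <;> rfl

theorem ren_sub {l : ℕ} (t : Tm l) : ∀ {m n : ℕ} (ρ : Var l → Var m) (σ : Var m → Tm n),
    (t.ren ρ).sub σ = t.sub (fun i => σ (ρ i)) := by
  induction t <;> intros <;> simp only [ren, sub, up_lift, *]

theorem lift_up {l m n : ℕ} (σ : Var l → Tm m) (ρ : Var m → Var n) :
    (fun i => (up σ i).ren (Var.lift ρ)) = up (fun i => (σ i).ren ρ) := by
  funext i; cases i with
  | z => rfl
  | s i => simp only [up, wk, ren_ren]; rfl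

theorem sub_ren {l : ℕ} (t : Tm l) : ∀ {m n : ℕ} (σ : Var l → Tm m) (ρ : Var m → Var n),
    (t.sub σ).ren ρ = t.sub (fun i => (σ i).ren ρ) := by
  induction t <;> intros <;> simp only [ren, sub, lift_up, *]

theorem up_up {l m n : ℕ} (σ : Var l → Tm m) (τ : Var m → Tm n) :
    (fun i => (up σ i).sub (up τ)) = up (fun i => (σ i).sub τ) := by
  funext i; cases i with
  | z => rfl
  | s i => simp only [up, wk, ren_sub, sub_ren]

theorem sub_sub {l : ℕ} (t : Tm l) : ∀ {m n : ℕ} (σ : Var l → Tm m) (τ : Var m → Tm n),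
    (t.sub σ).sub τ = t.sub (fun i => (σ i).sub τ) := by
  induction t <;> intros <;> simp only [sub, up_up, *]

theorem up_var {n : ℕ} : up (var : Var n → Tm n) = var := by
  funext i; cases i <;> rfl

theorem sub_var {n : ℕ} (t : Tm n) : t.sub var = t := by
  induction t <;> simp only [sub, up_var, *]

theorem wk_sub {m n : ℕ} (t : Tm m) (σ : Var (m + 1) → Tm n) :
    t.wk.sub σ = t.sub (fun i => σ (.s i)) := ren_sub t _ _

theorem sub_wk {m n : ℕ} (t : Tm m) (σ : Var m → Tm n) :
    (t.sub σ).wk = t.sub (fun i => (σ i).wk) := sub_ren t _ _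

theorem ren_eq_sub {m n : ℕ} (t : Tm m) (ρ : Var m → Var n) :
    t.ren ρ = t.sub (fun i => var (ρ i)) := by
  have := ren_sub t ρ var
  rwa [sub_var] at this

theorem wk_eq_sub {n : ℕ} (t : Tm n) : t.wk = t.sub (fun i => var (.s i)) := ren_eq_sub t _

end Tm

/-! ## Derived rules -/

open Tm

/-- Inversion of context formation. -/
def CtxInv : ∀ {n : ℕ}, Ctx n → Prop
  | _, .nil => True
  | _, .snoc Γ A => Der Γ (.set A)

theorem Der.ctx_inv {n : ℕ} {Γ : Ctx n} {J : Jdg n} (h : Der Γ J) : Der Γ .ctx ∧ CtxInv Γ := by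
  induction h with
  | ctx_nil => exact ⟨.ctx_nil, trivial⟩
  | ctx_snoc h => exact ⟨.ctx_snoc h, h⟩
  | case_elem i _ _ _ ih => exact ih i
  | _ => assumption

theorem Der.ctx {n : ℕ} {Γ : Ctx n} {J : Jdg n} (h : Der Γ J) : Der Γ .ctx := h.ctx_inv.1

theorem Der.last_set {n : ℕ} {Γ : Ctx n} {A : Tm n} {J : Jdg (n + 1)} (h : Der (Γ.snoc A) J) :
    Der Γ (.set A) := h.ctx_inv.2

/-- Well-typed substitutions. -/
structure IsSub {m n : ℕ} (Δ : Ctx n) (Γ : Ctx m) (σ : Var m → Tm n) : Prop where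
  ctx : Der Δ .ctx
  mem : ∀ i, Der Δ (.mem (σ i) ((Γ.get i).sub σ))

theorem Der.sub_set {m n : ℕ} {Δ : Ctx n} {Γ : Ctx m} {σ : Var m → Tm n} {A : Tm m}
    (h : Der Γ (.set A)) (hσ : IsSub Δ Γ σ) : Der Δ (.set (A.sub σ)) := h.subst hσ.1 hσ.2

theorem Der.sub_mem {m n : ℕ} {Δ : Ctx n} {Γ : Ctx m} {σ : Var m → Tm n} {a A : Tm m}
    (h : Der Γ (.mem a A)) (hσ : IsSub Δ Γ σ) : Der Δ (.mem (a.sub σ) (A.sub σ)) :=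
  h.subst hσ.1 hσ.2

theorem IsSub.scons {m n : ℕ} {Δ : Ctx n} {Γ : Ctx m} {σ : Var m → Tm n} {A : Tm m} {t : Tm n}
    (hσ : IsSub Δ Γ σ) (ht : Der Δ (.mem t (A.sub σ))) :
    IsSub Δ (Γ.snoc A) (scons t σ) := by
  refine ⟨hσ.1, fun i => ?_⟩
  cases i with
  | z => simpa only [Ctx.get, wk_sub, Tm.scons] using ht
  | s i => simpa only [Ctx.get, wk_sub, Tm.scons] using hσ.2 i

theorem IsSub.wk {m n : ℕ} {Δ : Ctx n} {Γ : Ctx m} {σ : Var m → Tm n} {A : Tm n}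
    (hσ : IsSub Δ Γ σ) (hA : Der Δ (.set A)) :
    IsSub (Δ.snoc A) Γ (fun i => (σ i).wk) := by
  refine ⟨hA.ctx_snoc, fun i => ?_⟩
  have h := (hσ.2 i).subst (J := .mem _ _) (Δ := Δ.snoc A) (σ := fun i => var (.s i)) hA.ctx_snoc
    (fun j => by
      rw [← wk_eq_sub]
      exact .assumption (.s j) hA.ctx_snoc)
  simpa only [Jdg.sub, ← wk_eq_sub, sub_wk] using h

theorem IsSub.id {n : ℕ} {Γ : Ctx n} (h : Der Γ .ctx) : IsSub Γ Γ var :=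
  ⟨h, fun i => by rw [sub_var]; exact .assumption i h⟩

theorem IsSub.up {m n : ℕ} {Δ : Ctx n} {Γ : Ctx m} {σ : Var m → Tm n} {A : Tm m}
    (hσ : IsSub Δ Γ σ) (hA : Der Γ (.set A)) :
    IsSub (Δ.snoc (A.sub σ)) (Γ.snoc A) (up σ) := by
  have h := hA.sub_set hσ
  have : Tm.up σ = Tm.scons v0 (fun i => (σ i).wk) := by funext i; cases i <;> rfl
  rw [this]
  refine (hσ.wk h).scons ?_
  rw [← sub_wk]
  exact .assumption .z h.ctx_snoc

theorem IsSub.inst {n : ℕ} {Γ : Ctx n} {A a : Tm n} (ha : Der Γ (.mem a A)) :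
    IsSub Γ (Γ.snoc A) (Tm.scons a var) :=
  (IsSub.id ha.ctx).scons (by rwa [sub_var])

theorem Der.wk_set {n : ℕ} {Γ : Ctx n} {A B : Tm n} (h : Der Γ (.set B)) (hA : Der Γ (.set A)) :
    Der (Γ.snoc A) (.set B.wk) := by
  rw [wk_eq_sub]; exact h.sub_set ((IsSub.id h.ctx).wk hA)

theorem Der.wk_mem {n : ℕ} {Γ : Ctx n} {A b B : Tm n} (h : Der Γ (.mem b B))
    (hA : Der Γ (.set A)) : Der (Γ.snoc A) (.mem b.wk B.wk) := by
  rw [wk_eq_sub, wk_eq_sub]; exact h.sub_mem ((IsSub.id h.ctx).wk hA)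

theorem Der.inst_set {n : ℕ} {Γ : Ctx n} {A a : Tm n} {B : Tm (n + 1)}
    (h : Der (Γ.snoc A) (.set B)) (ha : Der Γ (.mem a A)) : Der Γ (.set (B.inst a)) :=
  h.sub_set (.inst ha)

theorem Der.inst_mem {n : ℕ} {Γ : Ctx n} {A a : Tm n} {b B : Tm (n + 1)}
    (h : Der (Γ.snoc A) (.mem b B)) (ha : Der Γ (.mem a A)) :
    Der Γ (.mem (b.inst a) (B.inst a)) :=
  h.sub_mem (.inst ha)

theorem Der.last {n : ℕ} {Γ : Ctx n} {A : Tm n} (hA : Der Γ (.set A)) :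
    Der (Γ.snoc A) (.mem v0 A.wk) := .assumption .z hA.ctx_snoc

theorem wk_inst {n : ℕ} (A a : Tm n) : A.wk.inst a = A := by
  rw [inst, wk_sub]; exact sub_var A

/-- Transport along a proof of identity. -/
theorem Der.transport {n : ℕ} {Γ : Ctx n} {A a b p u : Tm n} {P : Tm (n + 1)}
    (hP : Der (Γ.snoc A) (.set P)) (ha : Der Γ (.mem a A)) (hb : Der Γ (.mem b A))
    (hp : Der Γ (.mem p (Id A a b))) (hu : Der Γ (.mem u (P.inst a))) :
    ∃ v, Der Γ (.mem v (P.inst b)) := by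
  have hA : Der Γ (.set A) := hP.last_set
  have hA₁ := hA.wk_set hA
  have hI : Der ((Γ.snoc A).snoc A.wk) (.set (Id A.wk.wk v1 v0)) :=
    .id_form (hA₁.wk_set hA₁) (hA.last.wk_mem hA₁) hA₁.last
  let C : Tm (n + 3) := Pi (P.instAt 3 v2) (P.instAt 4 v2)
  have s₃ := (((IsSub.id hA.ctx).wk hA).wk hA₁).wk hI
  have hPx : Der (((Γ.snoc A).snoc A.wk).snoc (Id A.wk.wk v1 v0)) (.set (P.instAt 3 v2)) := by
    refine hP.sub_set (s₃.scons ?_)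
    have := (hA.last.wk_mem hA₁).wk_mem hI
    simpa only [wk_eq_sub, sub_sub, sub, v0, v2] using this
  have hPy : Der ((((Γ.snoc A).snoc A.wk).snoc (Id A.wk.wk v1 v0)).snoc (P.instAt 3 v2))
      (.set (P.instAt 4 v2)) := by
    refine hP.sub_set ((s₃.wk hPx).scons ?_)
    have := (hA₁.last.wk_mem hI).wk_mem hPx
    simpa only [wk_eq_sub, sub_sub, sub, v0, v2] using this
  have hC := Der.pi_form hPx hPy
  have hd : Der (Γ.snoc A) (.mem (Tm.lam v0) (C.sub (Tm.scons (Tm.refl v0) (Tm.scons v0 var)))) := by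
    have e : C.sub (Tm.scons (Tm.refl v0) (Tm.scons v0 var)) = Pi P P.wk := by
      simp only [C, sub, instAt, sub_sub, wk_eq_sub, Pi.injEq]
      constructor
      · conv_rhs => rw [← sub_var P]
        congr 1; funext i; cases i <;> rfl
      · congr 1; funext i; cases i <;> rfl
    rw [e]
    exact .lam hP hP.last
  have hJ := Der.idpeel hC ha hb hp hd
  have e : C.sub (Tm.scons p (Tm.scons b (Tm.scons a var))) = Pi (P.inst a) (P.inst b).wk := by
    simp only [C, sub, instAt, inst, sub_sub, wk_eq_sub, Pi.injEq]
    constructor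
    · congr 1; funext i; cases i <;> rfl
    · congr 1; funext i
      cases i with
      | z => exact wk_eq_sub b
      | s i => rfl
  rw [e] at hJ
  have h := Der.app ((hP.inst_set hb).wk_set (hP.inst_set ha)) hJ hu
  rw [wk_inst] at h
  exact ⟨_, h⟩

/-- Propositional equality of elements. -/
def IdInh {n : ℕ} (Γ : Ctx n) (A a b : Tm n) : Prop := ∃ p, Der Γ (.mem p (Id A a b))

theorem IdInh.of_eq {n : ℕ} {Γ : Ctx n} {A a b : Tm n} (hA : Der Γ (.set A))
    (ha : Der Γ (.mem a A)) (h : Der Γ (.eqMem a b A)) : IdInh Γ A a b :=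
  ⟨_, (Der.refl ha).conv (.id_form_eq (.set_refl hA) (.mem_refl ha) h)⟩

/-- Functions of one variable preserve propositional equality. -/
theorem IdInh.congr {n : ℕ} {Γ : Ctx n} {A B a b : Tm n} {s : Tm (n + 1)}
    (hB : Der Γ (.set B)) (hs : Der (Γ.snoc A) (.mem s B.wk)) (ha : Der Γ (.mem a A))
    (hb : Der Γ (.mem b A)) (h : IdInh Γ A a b) : IdInh Γ B (s.inst a) (s.inst b) := by
  obtain ⟨p, hp⟩ := h
  have hA := hs.last_set
  have hsa := hs.inst_mem ha
  rw [wk_inst] at hsa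
  have hP : Der (Γ.snoc A) (.set (Id B.wk (s.inst a).wk s)) :=
    .id_form (hB.wk_set hA) (hsa.wk_mem hA) hs
  have e : ∀ c, (Id B.wk (s.inst a).wk s).inst c = Id B (s.inst a) (s.inst c) := by
    intro c
    have h₁ := wk_inst B c
    have h₂ := wk_inst (s.inst a) c
    simp only [inst] at h₁ h₂ ⊢
    simp only [sub, h₁, h₂]
  have := Der.transport (u := Tm.refl (s.inst a)) hP ha hb hp (by rw [e]; exact .refl hsa)
  rwa [e] at this

theorem IdInh.trans {n : ℕ} {Γ : Ctx n} {A a b c : Tm n} (hA : Der Γ (.set A))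
    (ha : Der Γ (.mem a A)) (hb : Der Γ (.mem b A)) (hc : Der Γ (.mem c A))
    (h : IdInh Γ A a b) (h₁ : IdInh Γ A b c) : IdInh Γ A a c := by
  obtain ⟨p, hp⟩ := h
  obtain ⟨q, hq⟩ := h₁
  have hP : Der (Γ.snoc A) (.set (Id A.wk a.wk v0)) :=
    .id_form (hA.wk_set hA) (ha.wk_mem hA) hA.last
  have e : ∀ c, (Id A.wk a.wk v0).inst c = Id A a c := by
    intro c
    have h₁ := wk_inst A c
    have h₂ := wk_inst a c
    simp only [inst] at h₁ h₂ ⊢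
    simp only [sub, h₁, h₂]; rfl
  have := Der.transport (u := p) hP hb hc hq (by rwa [e])
  rwa [e] at this

theorem IdInh.symm {n : ℕ} {Γ : Ctx n} {A a b : Tm n} (hA : Der Γ (.set A))
    (ha : Der Γ (.mem a A)) (hb : Der Γ (.mem b A)) (h : IdInh Γ A a b) : IdInh Γ A b a := by
  obtain ⟨p, hp⟩ := h
  have hP : Der (Γ.snoc A) (.set (Id A.wk v0 a.wk)) :=
    .id_form (hA.wk_set hA) hA.last (ha.wk_mem hA)
  have e : ∀ c, (Id A.wk v0 a.wk).inst c = Id A c a := by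
    intro c
    have h₁ := wk_inst A c
    have h₂ := wk_inst a c
    simp only [inst] at h₁ h₂ ⊢
    simp only [sub, h₁, h₂]; rfl
  have := Der.transport (u := Tm.refl a) hP ha hb hp (by rw [e]; exact .refl ha)
  rwa [e] at this

/-! Binary products of sets, and their projections. -/

/-- First projection. -/
def Tm.fst {n : ℕ} (c : Tm n) : Tm n := Tm.split c v1

/-- Second projection. -/
def Tm.snd {n : ℕ} (c : Tm n) : Tm n := Tm.split c v0

/-- The product `A × B`, which is the sum of the constant family `B` over `A`. -/
def Tm.prod {n : ℕ} (A B : Tm n) : Tm n := Tm.Sig A B.wk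

theorem Tm.prod_sub {m n : ℕ} (A B : Tm m) (σ : Var m → Tm n) :
    (A.prod B).sub σ = (A.sub σ).prod (B.sub σ) := by
  simp only [Tm.prod, Tm.sub, wk_sub, sub_wk]; rfl

theorem Tm.fst_sub {m n : ℕ} (c : Tm m) (σ : Var m → Tm n) : c.fst.sub σ = (c.sub σ).fst := rfl

theorem Tm.snd_sub {m n : ℕ} (c : Tm m) (σ : Var m → Tm n) : c.snd.sub σ = (c.sub σ).snd := rfl

theorem wk_instAt {n : ℕ} (A : Tm n) (t : Tm (n + 2)) : A.wk.instAt 2 t = A.wk.wk := by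
  simp only [instAt, wk_eq_sub, sub_sub]; rfl

theorem Der.prod {n : ℕ} {Γ : Ctx n} {A B : Tm n} (hA : Der Γ (.set A)) (hB : Der Γ (.set B)) :
    Der Γ (.set (A.prod B)) := .sig_form hA (hB.wk_set hA)

theorem Der.pair_mem {n : ℕ} {Γ : Ctx n} {A B a b : Tm n} (hA : Der Γ (.set A))
    (hB : Der Γ (.set B)) (ha : Der Γ (.mem a A)) (hb : Der Γ (.mem b B)) :
    Der Γ (.mem (Tm.pair a b) (A.prod B)) :=
  .pair (hB.wk_set hA) ha (by rwa [wk_inst])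

theorem Der.fst_body {n : ℕ} {Γ : Ctx n} {A B : Tm n} (hA : Der Γ (.set A))
    (hB : Der Γ (.set B)) :
    Der ((Γ.snoc A).snoc B.wk) (.mem v1 (A.wk.instAt 2 (Tm.pair v1 v0))) := by
  rw [wk_instAt]; exact .assumption (.s .z) (hB.wk_set hA).ctx_snoc

theorem Der.snd_body {n : ℕ} {Γ : Ctx n} {A B : Tm n} (hA : Der Γ (.set A))
    (hB : Der Γ (.set B)) :
    Der ((Γ.snoc A).snoc B.wk) (.mem v0 (B.wk.instAt 2 (Tm.pair v1 v0))) := by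
  rw [wk_instAt]; exact .assumption .z (hB.wk_set hA).ctx_snoc

theorem Der.fst_mem {n : ℕ} {Γ : Ctx n} {A B c : Tm n} (hA : Der Γ (.set A))
    (hB : Der Γ (.set B)) (hc : Der Γ (.mem c (A.prod B))) : Der Γ (.mem c.fst A) := by
  have := Der.split (hA.wk_set (hA.prod hB)) hc (Der.fst_body hA hB)
  rwa [wk_inst] at this

theorem Der.snd_mem {n : ℕ} {Γ : Ctx n} {A B c : Tm n} (hA : Der Γ (.set A))
    (hB : Der Γ (.set B)) (hc : Der Γ (.mem c (A.prod B))) : Der Γ (.mem c.snd B) := by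
  have := Der.split (hB.wk_set (hA.prod hB)) hc (Der.snd_body hA hB)
  rwa [wk_inst] at this

theorem Der.fst_pair {n : ℕ} {Γ : Ctx n} {A B a b : Tm n} (hA : Der Γ (.set A))
    (hB : Der Γ (.set B)) (ha : Der Γ (.mem a A)) (hb : Der Γ (.mem b B)) :
    Der Γ (.eqMem (Tm.pair a b).fst a A) := by
  have := Der.split_pair (hA.wk_set (hA.prod hB)) ha (by rwa [wk_inst]) (Der.fst_body hA hB)
  rwa [wk_inst] at this

theorem Der.snd_pair {n : ℕ} {Γ : Ctx n} {A B a b : Tm n} (hA : Der Γ (.set A))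
    (hB : Der Γ (.set B)) (ha : Der Γ (.mem a A)) (hb : Der Γ (.mem b B)) :
    Der Γ (.eqMem (Tm.pair a b).snd b B) := by
  have := Der.split_pair (hB.wk_set (hA.prod hB)) ha (by rwa [wk_inst]) (Der.snd_body hA hB)
  rwa [wk_inst] at this

/-- Every element of a product is propositionally equal to the pair of its projections. -/
theorem IdInh.pair_eta {n : ℕ} {Γ : Ctx n} {A B c : Tm n} (hA : Der Γ (.set A))
    (hB : Der Γ (.set B)) (hc : Der Γ (.mem c (A.prod B))) :
    IdInh Γ (A.prod B) (Tm.pair c.fst c.snd) c := by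
  have hP := hA.prod hB
  have hA₁ := hA.wk_set hP
  have hB₁ := hB.wk_set hP
  have hz : Der (Γ.snoc (A.prod B)) (.mem v0 (A.wk.prod B.wk)) := by
    have e : A.wk.prod B.wk = (A.prod B).wk := by
      simp only [wk_eq_sub, Tm.prod_sub]
    rw [e]; exact hP.last
  have hC : Der (Γ.snoc (A.prod B))
      (.set (Id (A.wk.prod B.wk) (Tm.pair (Tm.fst v0) (Tm.snd v0)) v0)) :=
    .id_form (hA₁.prod hB₁)
      (.pair_mem hA₁ hB₁ (.fst_mem hA₁ hB₁ hz) (.snd_mem hA₁ hB₁ hz)) hz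
  have hBA := hB.wk_set hA
  have hA₂ : Der ((Γ.snoc A).snoc B.wk) (.set A.wk.wk) := (hA.wk_set hA).wk_set hBA
  have hB₂ : Der ((Γ.snoc A).snoc B.wk) (.set B.wk.wk) := hBA.wk_set hBA
  have hx : Der ((Γ.snoc A).snoc B.wk) (.mem v1 A.wk.wk) := .assumption (.s .z) hBA.ctx_snoc
  have hy : Der ((Γ.snoc A).snoc B.wk) (.mem v0 B.wk.wk) := .assumption .z hBA.ctx_snoc
  have hd : Der ((Γ.snoc A).snoc B.wk) (.mem (Tm.refl (Tm.pair v1 v0))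
      ((Id (A.wk.prod B.wk) (Tm.pair (Tm.fst v0) (Tm.snd v0)) v0).instAt 2 (Tm.pair v1 v0))) := by
    have e : (Id (A.wk.prod B.wk) (Tm.pair (Tm.fst v0) (Tm.snd v0)) v0).instAt 2 (Tm.pair v1 v0)
        = Id (A.wk.wk.prod B.wk.wk) (Tm.pair (Tm.pair v1 v0).fst (Tm.pair v1 v0).snd)
          (Tm.pair v1 v0) := by
      have h₁ := wk_instAt A (Tm.pair v1 v0)
      have h₂ := wk_instAt B (Tm.pair v1 v0)
      simp only [instAt] at h₁ h₂ ⊢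
      simp only [Tm.sub, Tm.prod_sub, h₁, h₂]; rfl
    rw [e]
    have hp := Der.pair_mem hA₂ hB₂ hx hy
    refine (Der.refl hp).conv (.id_form_eq (.set_refl (hA₂.prod hB₂)) (.mem_symm ?_)
      (.mem_refl hp))
    refine .pair_eq (hB₂.wk_set hA₂) (.fst_pair hA₂ hB₂ hx hy) ?_
    rw [wk_inst]; exact .snd_pair hA₂ hB₂ hx hy
  have := Der.split hC hc hd
  have e : (Id (A.wk.prod B.wk) (Tm.pair (Tm.fst v0) (Tm.snd v0)) v0).inst c
      = Id (A.prod B) (Tm.pair c.fst c.snd) c := by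
    have h₁ := wk_inst A c
    have h₂ := wk_inst B c
    simp only [inst] at h₁ h₂ ⊢
    simp only [Tm.sub, Tm.prod_sub, h₁, h₂]; rfl
  rw [e] at this
  exact ⟨_, this⟩

theorem IdInh.pair_congr {n : ℕ} {Γ : Ctx n} {A B a a₁ b b₁ : Tm n} (hA : Der Γ (.set A))
    (hB : Der Γ (.set B)) (ha : Der Γ (.mem a A)) (ha₁ : Der Γ (.mem a₁ A))
    (hb : Der Γ (.mem b B)) (hb₁ : Der Γ (.mem b₁ B)) (h : IdInh Γ A a a₁)
    (h₁ : IdInh Γ B b b₁) : IdInh Γ (A.prod B) (Tm.pair a b) (Tm.pair a₁ b₁) := by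
  have hP := hA.prod hB
  have ep : (A.prod B).wk = A.wk.prod B.wk := by
    simp only [wk_eq_sub, Tm.prod_sub]
  have e₁ : ∀ c d : Tm n, (Tm.pair v0 d.wk).inst c = Tm.pair c d := by
    intro c d
    have h := wk_inst d c
    simp only [inst] at h ⊢
    simp only [Tm.sub, h]; rfl
  have e₂ : ∀ c d : Tm n, (Tm.pair d.wk v0).inst c = Tm.pair d c := by
    intro c d
    have h := wk_inst d c
    simp only [inst] at h ⊢
    simp only [Tm.sub, h]; rfl
  have s₁ : IdInh Γ (A.prod B) (Tm.pair a b) (Tm.pair a₁ b) := by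
    have := IdInh.congr (s := Tm.pair v0 b.wk) hP
      (by rw [ep]
          exact .pair_mem (hA.wk_set hA) (hB.wk_set hA) hA.last (hb.wk_mem hA)) ha ha₁ h
    rwa [e₁, e₁] at this
  have s₂ : IdInh Γ (A.prod B) (Tm.pair a₁ b) (Tm.pair a₁ b₁) := by
    have := IdInh.congr (s := Tm.pair a₁.wk v0) hP
      (by rw [ep]
          exact .pair_mem (hA.wk_set hB) (hB.wk_set hB) (ha₁.wk_mem hB) hB.last) hb hb₁ h₁
    rwa [e₂, e₂] at this
  exact s₁.trans hP (.pair_mem hA hB ha hb) (.pair_mem hA hB ha₁ hb)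
    (.pair_mem hA hB ha₁ hb₁) s₂

/-- Any two elements of `N₁` are propositionally equal. -/
theorem IdInh.unit {n : ℕ} {Γ : Ctx n} {c : Tm n} (hc : Der Γ (.mem c (Enum 1))) :
    IdInh Γ (Enum 1) (Tm.elem 1 0) c := by
  have h₁ : Der Γ (.set (Enum 1)) := .enum_form 1 hc.ctx
  have hC : Der (Γ.snoc (Enum 1)) (.set (Id (Enum 1) (Tm.elem 1 0) v0)) :=
    .id_form (.enum_form 1 h₁.ctx_snoc) (.elem 0 h₁.ctx_snoc) h₁.last
  refine ⟨_, Der.case (d := fun _ => Tm.refl (Tm.elem 1 0)) hC hc fun i => ?_⟩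
  obtain rfl := Subsingleton.elim 0 i
  exact .refl (.elem 0 hc.ctx)

/-! ## The syntactic category -/

/-- Closed sets. -/
structure ML : Type where
  /-- the expression of a closed set -/
  carrier : Tm 0
  isSet : Der .nil (.set carrier)

namespace ML

/-- The context `x ∈ A`. -/
abbrev ctx (A : ML) : Ctx 1 := Ctx.nil.snoc A.carrier

/-- Terms `t ∈ B [x ∈ A]`. -/
def Term (A B : ML) : Type := {t : Tm 1 // Der A.ctx (.mem t B.carrier.wk)}

theorem ctx_der (A : ML) : Der A.ctx .ctx := A.isSet.ctx_snoc

theorem wk_isSet (A B : ML) : Der A.ctx (.set B.carrier.wk) := B.isSet.wk_set A.isSet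

theorem wk_carrier (B : ML) (σ : Var 1 → Tm 1) : B.carrier.wk.sub σ = B.carrier.wk := by
  rw [wk_sub, wk_eq_sub]; congr 1; funext i; cases i

theorem isSub {n : ℕ} {Δ : Ctx n} {B : ML} {t : Tm n} {σ : Var 0 → Tm n}
    (h : Der Δ (.mem t (B.carrier.sub σ))) : IsSub Δ B.ctx (fun _ => t) := by
  have e : (fun _ => t) = Tm.scons t σ := by
    funext i; rcases i with _ | i
    · rfl
    · cases i
  rw [e]
  exact IsSub.scons ⟨h.ctx, fun i => by cases i⟩ h

theorem Term.isSub {A B : ML} (t : Term A B) : IsSub A.ctx B.ctx (fun _ => t.1) :=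
  ML.isSub (σ := fun i => .var (.s i)) (by rw [← wk_eq_sub]; exact t.2)

/-- Two terms `t, t' ∈ B [x ∈ A]` are equivalent if there is a proof-term
`p ∈ Id(B, t, t') [x ∈ A]`. -/
instance homSetoid (A B : ML) : Setoid (Term A B) where
  r t t₁ := ∃ p, Der A.ctx (.mem p (.Id B.carrier.wk t.1 t₁.1))
  iseqv :=
    { refl := fun t => ⟨_, .refl t.2⟩
      symm := fun {t t₁} h => IdInh.symm (wk_isSet A B) t.2 t₁.2 h
      trans := fun {t t₁ t₂} h h₁ => IdInh.trans (wk_isSet A B) t.2 t₁.2 t₂.2 h h₁ }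

/-- Arrows are equivalence classes of terms. -/
def Hom (A B : ML) : Type := Quotient (homSetoid A B)

/-- The term `x ∈ A [x ∈ A]`. -/
def Term.id (A : ML) : Term A A := ⟨v0, A.isSet.last⟩

/-- The term `s(t) ∈ C [x ∈ A]`, for `t ∈ B [x ∈ A]` and `s ∈ C [y ∈ B]`. -/
def Term.comp {A B C : ML} (t : Term A B) (s : Term B C) : Term A C :=
  ⟨s.1.sub (fun _ => t.1), by
    have := s.2.sub_mem t.isSub
    rwa [wk_carrier] at this⟩

theorem Term.comp_congr {A B C : ML} (t t₁ : Term A B) (h : t ≈ t₁) (s s₁ : Term B C)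
    (h₁ : s ≈ s₁) : t.comp s ≈ t₁.comp s₁ := by
  obtain ⟨q, hq⟩ := h₁
  have k : IdInh A.ctx C.carrier.wk (t.comp s).1 (t.comp s₁).1 := by
    have := hq.sub_mem t.isSub
    simp only [Tm.sub, wk_carrier] at this
    exact ⟨_, this⟩
  have hs : Der (A.ctx.snoc B.carrier.wk)
      (.mem (s₁.1.sub (fun _ => (v0 : Tm 2))) C.carrier.wk.wk) := by
    have hv := (wk_isSet A B).last
    have e : ∀ D : ML, D.carrier.wk.wk = D.carrier.sub (fun i => (.var (.s (.s i)) : Tm 2)) := by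
      intro D; simp only [wk_eq_sub, Tm.sub_sub]; rfl
    rw [e] at hv
    have := s₁.2.sub_mem (ML.isSub hv)
    rw [wk_sub] at this
    rw [e]
    convert this using 3
    funext i; cases i
  have k₁ : IdInh A.ctx C.carrier.wk (t.comp s₁).1 (t₁.comp s₁).1 := by
    have := IdInh.congr (wk_isSet A C) hs t.2 t₁.2 h
    rw [inst, inst, Tm.sub_sub, Tm.sub_sub] at this
    exact this
  exact k.trans (wk_isSet A C) (t.comp s).2 (t.comp s₁).2 (t₁.comp s₁).2 k₁

/-- The category of closed sets and terms up to propositional equality. -/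
instance : Category.{0} ML where
  Hom := Hom
  id A := Quotient.mk _ (Term.id A)
  comp {A B C} := Quotient.map₂ (Term.comp (A := A) (B := B) (C := C)) Term.comp_congr
  id_comp {A B} f := by
    induction f using Quotient.inductionOn with
    | _ t =>
      refine congrArg (Quotient.mk _) (Subtype.ext ?_)
      change t.1.sub (fun _ => v0) = t.1
      conv_rhs => rw [← sub_var t.1]
      congr 1; funext i
      rcases i with _ | i
      · rfl
      · cases i
  comp_id {A B} f := by
    induction f using Quotient.inductionOn with
    | _ t => rfl
  assoc {A B C D} f g h := by
    induction f using Quotient.inductionOn with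
    | _ t =>
      induction g using Quotient.inductionOn with
      | _ s =>
        induction h using Quotient.inductionOn with
        | _ r => exact congrArg (Quotient.mk _) (Subtype.ext (Tm.sub_sub r.1 _ _).symm)

/-- The arrow `⌊t ∈ B [x ∈ A]⌋`. -/
def Term.hom {A B : ML} (t : Term A B) : A ⟶ B := Quotient.mk (homSetoid A B) t

theorem Term.hom_eq_iff {A B : ML} (t t₁ : Term A B) :
    t.hom = t₁.hom ↔ IdInh A.ctx B.carrier.wk t.1 t₁.1 :=
  ⟨fun h => Quotient.exact h, fun h => Quotient.sound h⟩

theorem Term.hom_comp {A B C : ML} (t : Term A B) (s : Term B C) :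
    t.hom ≫ s.hom = (t.comp s).hom := rfl

theorem exists_hom {A B : ML} (f : A ⟶ B) : ∃ t : Term A B, t.hom = f := Quotient.exists_rep f

/-- A term representing an arrow. -/
noncomputable def rep {A B : ML} (f : A ⟶ B) : Term A B := (exists_hom f).choose

theorem rep_hom {A B : ML} (f : A ⟶ B) : (rep f).hom = f := (exists_hom f).choose_spec

/-! Finite products: the singleton set `N₁`, and `∑_{x ∈ A} B` with its projections. -/

/-- The singleton set. -/
def unit : ML := ⟨.Enum 1, .enum_form 1 .ctx_nil⟩

/-- The product `∑_{x ∈ A} B`. -/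
def prod (A B : ML) : ML := ⟨A.carrier.prod B.carrier, A.isSet.prod B.isSet⟩

theorem prod_wk (A B : ML) : (prod A B).carrier.wk = A.carrier.wk.prod B.carrier.wk := by
  simp only [prod, wk_eq_sub, Tm.prod_sub]

theorem prod_last (A B : ML) :
    Der (prod A B).ctx (.mem v0 (A.carrier.wk.prod B.carrier.wk)) := by
  rw [← prod_wk]; exact (prod A B).isSet.last

/-- `π₁(z) ∈ A [z ∈ ∑_{x ∈ A} B]`. -/
def fstTerm (A B : ML) : Term (prod A B) A :=
  ⟨Tm.fst v0, .fst_mem (wk_isSet _ A) (wk_isSet _ B) (prod_last A B)⟩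

/-- `π₂(z) ∈ B [z ∈ ∑_{x ∈ A} B]`. -/
def sndTerm (A B : ML) : Term (prod A B) B :=
  ⟨Tm.snd v0, .snd_mem (wk_isSet _ A) (wk_isSet _ B) (prod_last A B)⟩

/-- `⟨t, s⟩ ∈ ∑_{x ∈ A} B [x ∈ X]`. -/
def pairTerm {X A B : ML} (t : Term X A) (s : Term X B) : Term X (prod A B) :=
  ⟨Tm.pair t.1 s.1, by
    rw [prod_wk]; exact .pair_mem (wk_isSet X A) (wk_isSet X B) t.2 s.2⟩

/-- `N₁` is terminal. -/
def isTerminalUnit : IsTerminal unit :=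
  IsTerminal.ofUniqueHom (fun X => Term.hom (B := unit) ⟨.elem 1 0, .elem 0 X.ctx_der⟩)
    (fun X m => by
      obtain ⟨t, rfl⟩ := exists_hom m
      exact ((Term.hom_eq_iff _ _).2 (IdInh.unit t.2)).symm)

/-- `∑_{x ∈ A} B` is a product of `A` and `B`. -/
noncomputable def isLimitProd (A B : ML) :
    IsLimit (BinaryFan.mk (fstTerm A B).hom (sndTerm A B).hom) :=
  have h₁ : ∀ {X : ML} (t : Term X A) (s : Term X B),
      (pairTerm t s).hom ≫ (fstTerm A B).hom = t.hom := fun {X} t s =>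
    ((Term.hom_eq_iff _ _).2 ((IdInh.of_eq (wk_isSet X A) t.2 (.mem_symm
      (.fst_pair (wk_isSet X A) (wk_isSet X B) t.2 s.2))))).symm
  have h₂ : ∀ {X : ML} (t : Term X A) (s : Term X B),
      (pairTerm t s).hom ≫ (sndTerm A B).hom = s.hom := fun {X} t s =>
    ((Term.hom_eq_iff _ _).2 ((IdInh.of_eq (wk_isSet X B) s.2 (.mem_symm
      (.snd_pair (wk_isSet X A) (wk_isSet X B) t.2 s.2))))).symm
  BinaryFan.IsLimit.mk _ (fun f g => (pairTerm (rep f) (rep g)).hom)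
    (fun f g => (h₁ _ _).trans (rep_hom f)) (fun f g => (h₂ _ _).trans (rep_hom g))
    (fun {X} f g m hf hg => by
      obtain ⟨u, rfl⟩ := exists_hom m
      replace hf := (Term.hom_eq_iff (u.comp (fstTerm A B)) (rep f)).1 (hf.trans (rep_hom f).symm)
      replace hg := (Term.hom_eq_iff (u.comp (sndTerm A B)) (rep g)).1 (hg.trans (rep_hom g).symm)
      have hA := wk_isSet X A
      have hB := wk_isSet X B
      have hu : Der X.ctx (.mem u.1 (prod A B).carrier.wk) := u.2
      rw [prod_wk] at hu
      have hfu := Der.fst_mem hA hB hu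
      have hsu := Der.snd_mem hA hB hu
      have k₁ := IdInh.symm (hA.prod hB) (.pair_mem hA hB hfu hsu) hu (.pair_eta hA hB hu)
      have k₂ := IdInh.pair_congr hA hB hfu (rep f).2 hsu (rep g).2 hf hg
      have k := k₁.trans (hA.prod hB) hu (.pair_mem hA hB hfu hsu)
        (.pair_mem hA hB (rep f).2 (rep g).2) k₂
      rw [← prod_wk] at k
      exact (Term.hom_eq_iff _ _).2 k)

/-- The finite products of `ML`, chosen as above. -/
noncomputable instance : CartesianMonoidalCategory ML :=
  .ofChosenFiniteProducts ⟨_, isTerminalUnit⟩ (fun A B => ⟨_, isLimitProd A B⟩)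

/-! ## The doctrine of predicates -/

/-- Predicates `φ prop [x ∈ A]`; propositions are identified with sets. -/
def Pred (A : ML) : Type := {φ : Tm 1 // Der A.ctx (.set φ)}

/-- `φ ≤ ψ` if there is a proof-term `r ∈ ψ [x ∈ A, w ∈ φ]`. -/
instance (A : ML) : Preorder (Pred A) where
  le φ ψ := ∃ r, Der (A.ctx.snoc φ.1) (.mem r ψ.1.wk)
  le_refl φ := ⟨_, φ.2.last⟩
  le_trans φ ψ χ := by
    rintro ⟨r, hr⟩ ⟨s, hs⟩
    have h := hs.sub_mem (((IsSub.id φ.2.ctx).wk φ.2).scons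
      (t := r) (by rw [← sub_wk, sub_var]; exact hr))
    rw [wk_sub] at h
    change Der _ (.mem _ (χ.1.sub fun i => .var (.s i))) at h
    rw [← wk_eq_sub] at h
    exact ⟨_, h⟩

/-- The substitution `φ(t)`. -/
def Pred.subst {A B : ML} (t : Term A B) (φ : Pred B) : Pred A :=
  ⟨φ.1.sub (fun _ => t.1), φ.2.sub_set t.isSub⟩

/-- The conjunction `φ ∧ ψ`, which is the product of `φ` and `ψ`. -/
def Pred.and {A : ML} (φ ψ : Pred A) : Pred A := ⟨φ.1.prod ψ.1, φ.2.prod ψ.2⟩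

/-- The true proposition `N₁`. -/
def Pred.true (A : ML) : Pred A := ⟨.Enum 1, .enum_form 1 A.ctx_der⟩

theorem Pred.subst_mono {A B : ML} (t : Term A B) {φ ψ : Pred B} (h : φ ≤ ψ) :
    φ.subst t ≤ ψ.subst t := by
  obtain ⟨r, hr⟩ := h
  have := hr.sub_mem (t.isSub.up φ.2)
  rw [wk_sub] at this
  change Der _ (.mem _ (ψ.1.sub fun _ => t.1.wk)) at this
  rw [← sub_wk ψ.1 fun _ => t.1] at this
  exact ⟨_, this⟩

theorem Pred.subst_congr {A B : ML} {t t₁ : Term A B} (h : t.hom = t₁.hom) (φ : Pred B) :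
    φ.subst t ≤ φ.subst t₁ := by
  obtain ⟨p, hp⟩ := (Term.hom_eq_iff _ _).1 h
  have hF := (φ.subst t).2
  have hB : Der (A.ctx.snoc (φ.subst t).1) (.set B.carrier.wk.wk) := (wk_isSet A B).wk_set hF
  have e : ∀ D : ML, D.carrier.wk.wk.wk
      = D.carrier.sub (fun i => (.var (.s (.s (.s i))) : Tm 3)) := by
    intro D; simp only [wk_eq_sub, Tm.sub_sub]; rfl
  have hP : Der ((A.ctx.snoc (φ.subst t).1).snoc B.carrier.wk.wk)
      (.set (φ.1.sub (fun _ => (v0 : Tm 3)))) := by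
    have hv := hB.last
    rw [e] at hv
    exact φ.2.sub_set (ML.isSub hv)
  have k : ∀ s : Term A B, (φ.1.sub (fun _ => (v0 : Tm 3))).inst s.1.wk = (φ.subst s).1.wk := by
    intro s
    rw [inst, Tm.sub_sub, Pred.subst, sub_wk]; rfl
  have := Der.transport (u := v0) hP (t.2.wk_mem hF) (t₁.2.wk_mem hF) (hp.wk_mem hF)
    (by rw [k]; exact hF.last)
  rwa [k] at this

theorem Pred.subst_id {A : ML} (φ : Pred A) : φ.subst (Term.id A) = φ := by
  refine Subtype.ext ?_
  change φ.1.sub (fun _ => v0) = φ.1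
  conv_rhs => rw [← sub_var φ.1]
  congr 1; funext i
  rcases i with _ | i
  · rfl
  · cases i

theorem Pred.subst_comp {A B C : ML} (t : Term A B) (s : Term B C) (φ : Pred C) :
    φ.subst (t.comp s) = (φ.subst s).subst t :=
  Subtype.ext (Tm.sub_sub φ.1 _ _).symm

theorem Pred.and_le {A : ML} (φ ψ : Pred A) : φ.and ψ ≤ φ ∧ φ.and ψ ≤ ψ := by
  have h := (φ.and ψ).2
  have e : (φ.and ψ).1.wk = φ.1.wk.prod ψ.1.wk := by
    simp only [Pred.and, wk_eq_sub, Tm.prod_sub]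
  have hv := h.last
  rw [e] at hv
  exact ⟨⟨_, .fst_mem (φ.2.wk_set h) (ψ.2.wk_set h) hv⟩,
    ⟨_, .snd_mem (φ.2.wk_set h) (ψ.2.wk_set h) hv⟩⟩

theorem Pred.le_and {A : ML} {χ φ ψ : Pred A} (h : χ ≤ φ) (h₁ : χ ≤ ψ) : χ ≤ φ.and ψ := by
  obtain ⟨r, hr⟩ := h
  obtain ⟨s, hs⟩ := h₁
  have e : (φ.and ψ).1.wk = φ.1.wk.prod ψ.1.wk := by
    simp only [Pred.and, wk_eq_sub, Tm.prod_sub]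
  refine ⟨Tm.pair r s, ?_⟩
  rw [e]
  exact .pair_mem (φ.2.wk_set χ.2) (ψ.2.wk_set χ.2) hr hs

/-- The fibre over `A`: predicates up to equiprovability, ordered by provable consequence. -/
abbrev Fib (A : ML) : Type := Antisymmetrization (Pred A) (· ≤ ·)

instance (A : ML) : SemilatticeInf (Fib A) where
  inf := Quotient.map₂ Pred.and fun _ _ h _ _ k =>
    ⟨Pred.le_and ((Pred.and_le _ _).1.trans h.1) ((Pred.and_le _ _).2.trans k.1),
      Pred.le_and ((Pred.and_le _ _).1.trans h.2) ((Pred.and_le _ _).2.trans k.2)⟩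
  inf_le_left a b := by
    induction a using Quotient.inductionOn with
    | _ φ => induction b using Quotient.inductionOn with
      | _ ψ => exact (Pred.and_le φ ψ).1
  inf_le_right a b := by
    induction a using Quotient.inductionOn with
    | _ φ => induction b using Quotient.inductionOn with
      | _ ψ => exact (Pred.and_le φ ψ).2
  le_inf a b c := by
    induction a using Quotient.inductionOn with
    | _ χ => induction b using Quotient.inductionOn with
      | _ φ => induction c using Quotient.inductionOn with
        | _ ψ => exact Pred.le_and

instance (A : ML) : OrderTop (Fib A) where
  top := toAntisymmetrization _ (Pred.true A)
  le_top a := by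
    induction a using Quotient.inductionOn with
    | _ φ => exact ⟨.elem 1 0, .elem 0 φ.2.ctx_snoc⟩

/-- Reindexing along an arrow is substitution. -/
def reindex {A B : ML} (f : A ⟶ B) : InfTopHom (Fib B) (Fib A) where
  toFun := Quotient.lift (s := homSetoid A B)
    (fun t => Quotient.map (Pred.subst t)
      fun _ _ h => ⟨Pred.subst_mono t h.1, Pred.subst_mono t h.2⟩)
    (fun t t₁ h => by
      funext a
      induction a using Quotient.inductionOn with
      | _ φ =>
        have h : t.hom = t₁.hom := Quotient.sound h
        exact Quotient.sound ⟨Pred.subst_congr h φ, Pred.subst_congr h.symm φ⟩) f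
  map_inf' a b := by
    induction f using Quotient.inductionOn with
    | _ t => induction a using Quotient.inductionOn with
      | _ φ => induction b using Quotient.inductionOn with
        | _ ψ =>
          exact congrArg (Quotient.mk _) (Subtype.ext (Tm.prod_sub φ.1 ψ.1 fun _ => t.1))
  map_top' := by
    induction f using Quotient.inductionOn with
    | _ t => rfl

theorem reindex_id {A : ML} (a : Fib A) : reindex (𝟙 A) a = a := by
  induction a using Quotient.inductionOn with
  | _ φ => exact congrArg (Quotient.mk _) (Pred.subst_id φ)

theorem reindex_comp {A B C : ML} (f : A ⟶ B) (g : B ⟶ C) (a : Fib C) :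
    reindex (f ≫ g) a = reindex f (reindex g a) := by
  induction f using Quotient.inductionOn with
  | _ t => induction g using Quotient.inductionOn with
    | _ s => induction a using Quotient.inductionOn with
      | _ φ => exact congrArg (Quotient.mk _) (Pred.subst_comp t s φ)

end ML

/-- The doctrine of predicates over `ML`. -/
def FML : MLᵒᵖ ⥤ SemilatInfCat where
  obj A := .of (ML.Fib A.unop)
  map f := ML.reindex f.unop
  map_id _ := InfTopHom.ext ML.reindex_id
  map_comp f g := InfTopHom.ext (ML.reindex_comp g.unop f.unop)

/-! ## Weak evaluations -/

/-- A weak evaluation from `A` to `B`: an arrow `w : W × A ⟶ B` such that every `f : X × A ⟶ B`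
is `w ∘ (g × id)` for some, not necessarily unique, arrow `g : X ⟶ W`. -/
def IsWeakEvaluation {C : Type*} [Category* C] [CartesianMonoidalCategory C] {A B W : C}
    (w : W ⊗ A ⟶ B) : Prop :=
  ∀ (X : C) (f : X ⊗ A ⟶ B), ∃ g : X ⟶ W, f = (g ⊗ₘ 𝟙 A) ≫ w

/-- There is a weak evaluation for each pair of objects. -/
def WeaklyCartesianClosed (C : Type*) [Category* C] [CartesianMonoidalCategory C] : Prop :=
  ∀ A B : C, ∃ (W : C) (w : W ⊗ A ⟶ B), IsWeakEvaluation w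

namespace ML

/-- The dependent product `∏_{x ∈ A} B`. -/
def piSet (A B : ML) : ML := ⟨.Pi A.carrier B.carrier.wk, .pi_form A.isSet (B.isSet.wk_set A.isSet)⟩

/-- `π₁(z)(π₂(z)) ∈ B [z ∈ (∏_{x ∈ A} B) × A]`. -/
def evTerm (A B : ML) : Term (prod (piSet A B) A) B :=
  ⟨Tm.app (Tm.fst v0) (Tm.snd v0), by
    have hA := wk_isSet (prod (piSet A B) A) A
    have hB := wk_isSet (prod (piSet A B) A) B
    have hP := wk_isSet (prod (piSet A B) A) (piSet A B)
    have hz := prod_last (piSet A B) A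
    have hf := Der.fst_mem hP hA hz
    have e : (piSet A B).carrier.wk = .Pi A.carrier.wk B.carrier.wk.wk := by
      simp only [piSet, wk_eq_sub, Tm.sub, Tm.sub_sub]; rfl
    rw [e] at hf
    have := Der.app (hB.wk_set hA) hf (.snd_mem hP hA hz)
    rwa [wk_inst] at this⟩

/-- The arrow `⌊π₁(z)(π₂(z)) ∈ B [z ∈ (∏_{x ∈ A} B) × A]⌋`. -/
def ev (A B : ML) : piSet A B ⊗ A ⟶ B := (evTerm A B).hom

end ML

end MLTT

/-! Weak evaluation: an arrow `X × A → B` is represented by a term `t(z)`, and `λ y. t(⟨x, y⟩)` is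
its transpose. Evaluating the transpose at `z` gives, by the computation rules for pairs and by `β`,
the term `t(⟨π₁ z, π₂ z⟩)` up to judgemental equality. Surjective pairing, which holds
propositionally, identifies this with `t(z)`. No extensionality for functions is available or
needed, since uniqueness of the transpose is not claimed.

Right adjoints: along `t ∈ B [x ∈ A]` the quantifier is `(∀_t φ)(y) = ∏_{x ∈ A} (Id(B, t(x), y) →
φ(x))`. For `ψ(t(x)) ≤ φ(x)` to give `ψ ≤ ∀_t φ`, a proof of `ψ(y)` is transported along the
identity proof. For the converse, the quantified statement at `y = t(x)` is applied to `x` and to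
reflexivity. This is `Pred.subst_le_iff`.

Beck–Chevalley: one inequality is formal. For the other, form `Q = ∑_{z ∈ X × Y} Id(Z, f(π₁ z), g(π₂
z))`, whose projections to `X` and `Y` complete a commutative square with `f` and `g`. The square
therefore factors through any pullback `P`, and an inequality between predicates over `P` reindexes
to `Q`. There it can be read off at the elements `⟨⟨x, y⟩, p⟩`, and such an `x` with such a `p` is
exactly what `∀_f` abstracts over (`le_all_of_eqPred`). Only the existence of factorizations through
`P` is used, not their uniqueness. -/

namespace MLTT

open Tm

/-- Inhabited sets. -/
def Inh {n : ℕ} (Γ : Ctx n) (A : Tm n) : Prop := ∃ r, Der Γ (.mem r A)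

instance : IsEmpty (Var 0) := ⟨nofun⟩

namespace ML

/-! ### Closed sets and their terms in arbitrary contexts -/

/-- A closed set, seen in a context of length `n`. -/
def cl (A : ML) (n : ℕ) : Tm n := A.carrier.sub isEmptyElim

/-- There is only one substitution out of the empty context. Hence all weakenings and instances of a
closed set have the common normal form `cl`, and typing goals are compared in that form. -/
theorem sub_eq_cl (A : ML) {n : ℕ} (σ : Var 0 → Tm n) : A.carrier.sub σ = A.cl n := by
  rw [cl, Subsingleton.elim σ]

theorem cl_sub (A : ML) {m n : ℕ} (σ : Var m → Tm n) : (A.cl m).sub σ = A.cl n := by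
  rw [cl, Tm.sub_sub, sub_eq_cl]

theorem cl_wk (A : ML) (n : ℕ) : (A.cl n).wk = A.cl (n + 1) := by
  rw [wk_eq_sub, cl_sub]

theorem carrier_wk (A : ML) : A.carrier.wk = A.cl 1 := by
  rw [wk_eq_sub, sub_eq_cl]

theorem cl_inst (A : ML) {n : ℕ} (a : Tm n) : (A.cl (n + 1)).inst a = A.cl n := cl_sub A _

theorem cl_set (A : ML) {n : ℕ} {Δ : Ctx n} (h : Der Δ .ctx) : Der Δ (.set (A.cl n)) :=
  A.isSet.sub_set ⟨h, isEmptyElim⟩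

theorem isSub_of_mem {n : ℕ} {Δ : Ctx n} {A : ML} {a : Tm n} (h : Der Δ (.mem a (A.cl n))) :
    IsSub Δ A.ctx (fun _ => a) :=
  ML.isSub (σ := isEmptyElim) h

theorem last_mem (A : ML) {n : ℕ} {Δ : Ctx n} (h : Der Δ .ctx) :
    Der (Δ.snoc (A.cl n)) (.mem v0 (A.cl (n + 1))) := by
  rw [← cl_wk]; exact (A.cl_set h).last

theorem wk_mem_cl {A : ML} {n : ℕ} {Δ : Ctx n} {a C : Tm n} (h : Der Δ (.mem a (A.cl n)))
    (hC : Der Δ (.set C)) : Der (Δ.snoc C) (.mem a.wk (A.cl (n + 1))) := by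
  rw [← cl_wk]; exact h.wk_mem hC

theorem var_mem (A : ML) : Der A.ctx (.mem v0 (A.cl 1)) := by
  rw [← carrier_wk]; exact A.isSet.last

theorem Term.mem_cl {A B : ML} (t : Term A B) : Der A.ctx (.mem t.1 (B.cl 1)) :=
  (congrArg (fun C => Der A.ctx (.mem t.1 C)) B.carrier_wk).mp t.2

theorem Term.hom_eq_iff_cl {A B : ML} (t t₁ : Term A B) :
    t.hom = t₁.hom ↔ IdInh A.ctx (B.cl 1) t.1 t₁.1 :=
  (Term.hom_eq_iff t t₁).trans
    (iff_of_eq (congrArg (fun C => IdInh A.ctx C t.1 t₁.1) B.carrier_wk))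

theorem Term.sub_mem {A B : ML} (t : Term A B) {n : ℕ} {Δ : Ctx n} {a : Tm n}
    (h : Der Δ (.mem a (A.cl n))) : Der Δ (.mem (t.1.sub fun _ => a) (B.cl n)) := by
  have := t.mem_cl.sub_mem (isSub_of_mem h)
  rwa [cl_sub] at this

/-- Judgemental equality is preserved as such, so the result may be used inside types, where a
conversion is required. `Term.sub_congr` is the propositional counterpart. -/
theorem Term.sub_eq {A B : ML} (t : Term A B) {n : ℕ} {Δ : Ctx n} {a b : Tm n}
    (h : Der Δ (.eqMem a b (A.cl n))) :
    Der Δ (.eqMem (t.1.sub fun _ => a) (t.1.sub fun _ => b) (B.cl n)) := by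
  have := t.mem_cl.subst_mem_eq (Δ := Δ) (σ := fun _ => a) (τ := fun _ => b) h.ctx (by
    rintro (_ | i)
    · simpa only [Ctx.get, carrier_wk, cl_sub] using h
    · exact isEmptyElim i)
  rwa [cl_sub] at this

theorem Term.sub_wk_const {A B : ML} (t : Term A B) {n : ℕ} (a : Tm n) :
    (t.1.sub fun _ => a).wk = t.1.sub fun _ => a.wk := sub_wk _ _

theorem sub_const_v0 (t : Tm 1) : (t.sub fun _ => v0) = t := by
  conv_rhs => rw [← sub_var t]
  congr 1; funext i
  rcases i with _ | i
  · rfl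
  · exact isEmptyElim i

theorem Term.sub_congr {A B : ML} (t : Term A B) {n : ℕ} {Δ : Ctx n} {a b : Tm n}
    (h : Der Δ (.mem a (A.cl n))) (h₁ : Der Δ (.mem b (A.cl n))) (e : IdInh Δ (A.cl n) a b) :
    IdInh Δ (B.cl n) (t.1.sub fun _ => a) (t.1.sub fun _ => b) := by
  have := IdInh.congr (s := t.1.sub fun _ => v0) (B.cl_set h.ctx)
    (by rw [cl_wk]; exact t.sub_mem (A.last_mem h.ctx)) h h₁ e
  rwa [inst, inst, Tm.sub_sub, Tm.sub_sub] at this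

/-! ### Predicates at elements of arbitrary contexts -/

theorem Pred.sub_set {A : ML} (φ : Pred A) {n : ℕ} {Δ : Ctx n} {a : Tm n}
    (h : Der Δ (.mem a (A.cl n))) : Der Δ (.set (φ.1.sub fun _ => a)) :=
  φ.2.sub_set (isSub_of_mem h)

/-- Transport along the identity proof. Propositionally equal elements give predicates that imply
each other, although these need not be convertible as sets. -/
theorem Pred.sub_congr {A : ML} (φ : Pred A) {n : ℕ} {Δ : Ctx n} {a b : Tm n}
    (h : Der Δ (.mem a (A.cl n))) (h₁ : Der Δ (.mem b (A.cl n))) (e : IdInh Δ (A.cl n) a b)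
    (i : Inh Δ (φ.1.sub fun _ => a)) : Inh Δ (φ.1.sub fun _ => b) := by
  obtain ⟨p, hp⟩ := e
  obtain ⟨u, hu⟩ := i
  have k : ∀ c : Tm n, (φ.1.sub (fun _ => (v0 : Tm (n + 1)))).inst c = φ.1.sub fun _ => c :=
    fun c => Tm.sub_sub _ _ _
  have := Der.transport (u := u) (φ.sub_set (A.last_mem h.ctx)) h h₁ hp (by rwa [k])
  rwa [k] at this

theorem Pred.wk_eq {A : ML} (φ : Pred A) : φ.1.wk = φ.1.sub fun _ => v1 := by
  conv_lhs => rw [← sub_const_v0 φ.1]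
  exact sub_wk _ _

/-- Provable consequence, at a generic element. -/
theorem Pred.le_iff {A : ML} {φ ψ : Pred A} :
    φ ≤ ψ ↔ Inh (A.ctx.snoc φ.1) (ψ.1.sub fun _ => v1) := by
  rw [← ψ.wk_eq]; rfl

/-- Substituting the element and the proof of `φ` into the proof-term of the entailment makes the
entailment usable under further assumptions. -/
theorem Pred.le_sub {A : ML} {φ ψ : Pred A} (h : φ ≤ ψ) {n : ℕ} {Δ : Ctx n} {a : Tm n}
    (ha : Der Δ (.mem a (A.cl n))) (i : Inh Δ (φ.1.sub fun _ => a)) :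
    Inh Δ (ψ.1.sub fun _ => a) := by
  obtain ⟨r, hr⟩ := h
  obtain ⟨s, hs⟩ := i
  have := hr.sub_mem ((isSub_of_mem ha).scons hs)
  rw [wk_sub] at this
  exact ⟨_, this⟩

/-- The assumptions `x ∈ A`, `φ(x)`. -/
theorem Pred.hyp {A : ML} (φ : Pred A) :
    Der (A.ctx.snoc φ.1) (.mem v1 (A.cl 2)) ∧ Inh (A.ctx.snoc φ.1) (φ.1.sub fun _ => v1) := by
  refine ⟨wk_mem_cl A.var_mem φ.2, ⟨v0, ?_⟩⟩
  rw [← φ.wk_eq]; exact φ.2.last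

/-! ### Universal quantification along a term -/

/-- The family `(t(x) = y) → φ(x)` over `x ∈ A`. -/
def Pred.fibre {A B : ML} (t : Term A B) (φ : Pred A) {n : ℕ} (b : Tm n) : Tm (n + 1) :=
  .Pi (.Id (B.cl (n + 1)) (t.1.sub fun _ => v0) b.wk) (φ.1.sub fun _ => v1)

/-- The set `∏_{x ∈ A} ((t(x) = y) → φ(x))`. -/
def Pred.allAt {A B : ML} (t : Term A B) (φ : Pred A) {n : ℕ} (b : Tm n) : Tm n :=
  .Pi (A.cl n) (Pred.fibre t φ b)

theorem Pred.fibre_sub {A B : ML} (t : Term A B) (φ : Pred A) {m n : ℕ} (b : Tm m)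
    (σ : Var m → Tm n) : (Pred.fibre t φ b).sub (up σ) = Pred.fibre t φ (b.sub σ) := by
  simp only [Pred.fibre, Tm.sub, cl_sub, Tm.sub_sub, wk_sub, sub_wk]
  rfl

theorem Pred.allAt_sub {A B : ML} (t : Term A B) (φ : Pred A) {m n : ℕ} (b : Tm m)
    (σ : Var m → Tm n) : (Pred.allAt t φ b).sub σ = Pred.allAt t φ (b.sub σ) := by
  simp only [Pred.allAt, Tm.sub, cl_sub, fibre_sub]

theorem Pred.fibre_inst {A B : ML} (t : Term A B) (φ : Pred A) {n : ℕ} (b a : Tm n) :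
    (Pred.fibre t φ b).inst a
      = .Pi (.Id (B.cl n) (t.1.sub fun _ => a) b) (φ.1.sub fun _ => a).wk := by
  have := wk_inst b a
  simp only [inst] at this
  simp only [inst, Pred.fibre, Tm.sub, cl_sub, Tm.sub_sub, this, sub_wk]
  rfl

theorem Pred.fibre_id {A B : ML} (t : Term A B) {n : ℕ} {Δ : Ctx n} {b : Tm n}
    (hb : Der Δ (.mem b (B.cl n))) :
    Der (Δ.snoc (A.cl n)) (.set (.Id (B.cl (n + 1)) (t.1.sub fun _ => v0) b.wk)) :=
  .id_form (B.cl_set (A.cl_set hb.ctx).ctx_snoc) (t.sub_mem (A.last_mem hb.ctx))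
    (wk_mem_cl hb (A.cl_set hb.ctx))

theorem Pred.fibre_set {A B : ML} (t : Term A B) (φ : Pred A) {n : ℕ} {Δ : Ctx n} {b : Tm n}
    (hb : Der Δ (.mem b (B.cl n))) :
    Der (Δ.snoc (A.cl n)) (.set (Pred.fibre t φ b)) :=
  .pi_form (Pred.fibre_id t hb)
    (φ.sub_set (wk_mem_cl (A.last_mem hb.ctx) (Pred.fibre_id t hb)))

/-- Universal quantification along `t`: the predicate `∏_{x ∈ A} ((t(x) = y) → φ(x)) [y ∈ B]`. -/
def Pred.all {A B : ML} (t : Term A B) (φ : Pred A) : Pred B :=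
  ⟨Pred.allAt t φ v0, .pi_form (A.cl_set B.ctx_der) (Pred.fibre_set t φ B.var_mem)⟩

theorem Pred.all_sub {A B : ML} (t : Term A B) (φ : Pred A) {n : ℕ} (b : Tm n) :
    ((Pred.all t φ).1.sub fun _ => b) = Pred.allAt t φ b :=
  Pred.allAt_sub t φ v0 _

/-- Two abstractions, over the element and over the identity proof. Together with `Pred.all_elim`
this is all that is used about `Pred.all` from here on. -/
theorem Pred.all_intro {A B : ML} (t : Term A B) (φ : Pred A) {n : ℕ} {Δ : Ctx n} {b : Tm n}
    (hb : Der Δ (.mem b (B.cl n)))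
    (h : Inh ((Δ.snoc (A.cl n)).snoc (.Id (B.cl (n + 1)) (t.1.sub fun _ => v0) b.wk))
      (φ.1.sub fun _ => v1)) : Inh Δ ((Pred.all t φ).1.sub fun _ => b) := by
  obtain ⟨r, hr⟩ := h
  rw [Pred.all_sub]
  exact ⟨_, .lam (A.cl_set hb.ctx) (.lam (Pred.fibre_id t hb) hr)⟩

theorem Pred.all_elim {A B : ML} (t : Term A B) (φ : Pred A) {n : ℕ} {Δ : Ctx n} {a b : Tm n}
    (ha : Der Δ (.mem a (A.cl n))) (hb : Der Δ (.mem b (B.cl n)))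
    (e : IdInh Δ (B.cl n) (t.1.sub fun _ => a) b)
    (h : Inh Δ ((Pred.all t φ).1.sub fun _ => b)) : Inh Δ (φ.1.sub fun _ => a) := by
  obtain ⟨r, hr⟩ := h
  obtain ⟨p, hp⟩ := e
  rw [Pred.all_sub] at hr
  have h₁ := Der.app (Pred.fibre_set t φ hb) hr ha
  rw [Pred.fibre_inst] at h₁
  have h₂ := Der.app ((φ.sub_set ha).wk_set
    (.id_form (B.cl_set hb.ctx) (t.sub_mem ha) hb)) h₁ hp
  rw [wk_inst] at h₂
  exact ⟨_, h₂⟩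

/-- The assumptions `x ∈ A`, `t(x) = b`. -/
theorem Pred.fibre_hyp {A B : ML} (t : Term A B) {n : ℕ} {Δ : Ctx n} {b : Tm n}
    (hb : Der Δ (.mem b (B.cl n))) :
    Der ((Δ.snoc (A.cl n)).snoc (.Id (B.cl (n + 1)) (t.1.sub fun _ => v0) b.wk))
        (.mem v1 (A.cl (n + 2))) ∧
      Der ((Δ.snoc (A.cl n)).snoc (.Id (B.cl (n + 1)) (t.1.sub fun _ => v0) b.wk))
        (.mem b.wk.wk (B.cl (n + 2))) ∧
      IdInh ((Δ.snoc (A.cl n)).snoc (.Id (B.cl (n + 1)) (t.1.sub fun _ => v0) b.wk))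
        (B.cl (n + 2)) (t.1.sub fun _ => v1) b.wk.wk := by
  have hI := Pred.fibre_id (A := A) t hb
  refine ⟨wk_mem_cl (A.last_mem hb.ctx) hI, wk_mem_cl (wk_mem_cl hb hI.ctx_inv.2) hI, v0, ?_⟩
  have e : (Tm.Id (B.cl (n + 1)) (t.1.sub fun _ => v0) b.wk).wk
      = .Id (B.cl (n + 2)) (t.1.sub fun _ => v1) b.wk.wk := by
    rw [← cl_wk B (n + 1)]
    exact congrArg₂ (Tm.Id _) (t.sub_wk_const v0) rfl
  rw [← e]; exact hI.last

theorem Inh.wk {n : ℕ} {Δ : Ctx n} {A C : Tm n} (h : Inh Δ A) (hC : Der Δ (.set C)) :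
    Inh (Δ.snoc C) A.wk := h.elim fun _ h => ⟨_, h.wk_mem hC⟩

theorem Pred.inh_wk {A : ML} {φ : Pred A} {n : ℕ} {Δ : Ctx n} {a C : Tm n}
    (h : Inh Δ (φ.1.sub fun _ => a)) (hC : Der Δ (.set C)) :
    Inh (Δ.snoc C) (φ.1.sub fun _ => a.wk) := by
  rw [← sub_wk φ.1 fun _ => a]; exact Inh.wk h hC

theorem Pred.subst_sub {A B : ML} (t : Term A B) (φ : Pred B) {n : ℕ} (a : Tm n) :
    ((φ.subst t).1.sub fun _ => a) = φ.1.sub fun _ => t.1.sub fun _ => a := Tm.sub_sub _ _ _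

/-- The adjunction at the level of representatives: transport gives one direction, reflexivity the
other. -/
theorem Pred.subst_le_iff {A B : ML} (t : Term A B) (ψ : Pred B) (φ : Pred A) :
    ψ.subst t ≤ φ ↔ ψ ≤ Pred.all t φ := by
  constructor
  · intro h
    obtain ⟨hy, hw⟩ := ψ.hyp
    obtain ⟨hx, hy₂, he⟩ := Pred.fibre_hyp t hy
    refine Pred.le_iff.2 (Pred.all_intro t φ hy (Pred.le_sub h hx ?_))
    rw [Pred.subst_sub]
    have hI := Pred.fibre_id (A := A) t hy
    have hB := B.cl_set hx.ctx
    have ht := t.sub_mem hx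
    -- The assumption `ψ(y)`, weakened by `x` and by the proof of `t(x) = y`, is carried to
    -- `ψ(t(x))`.
    exact ψ.sub_congr hy₂ ht (he.symm hB ht hy₂) (Pred.inh_wk (Pred.inh_wk hw hI.ctx_inv.2) hI)
  · intro h
    obtain ⟨hx, hw⟩ := (ψ.subst t).hyp
    have ht := t.sub_mem hx
    rw [Pred.subst_sub] at hw
    -- The quantified statement is taken at the point `t(x)`, so that reflexivity is the required
    -- identity proof.
    exact Pred.le_iff.2 (Pred.all_elim t φ hx ht ⟨_, .refl ht⟩ (Pred.le_sub h ht hw))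

/-! ### Comprehension, and the set of pairs with equal images -/

/-- The comprehension `∑_{x ∈ A} φ(x)` of a predicate. -/
def Pred.compr {A : ML} (φ : Pred A) : ML := ⟨.Sig A.carrier φ.1, .sig_form A.isSet φ.2⟩

theorem Pred.compr_cl {A : ML} (φ : Pred A) (n : ℕ) :
    φ.compr.cl n = .Sig (A.cl n) (φ.1.sub fun _ => v0) := by
  simp only [Pred.compr, cl, Tm.sub, Sig.injEq, true_and]
  congr 1; funext i
  rcases i with _ | i
  · rfl
  · exact isEmptyElim i

theorem Pred.compr_body {A : ML} (φ : Pred A) {n : ℕ} {Δ : Ctx n} (h : Der Δ .ctx) :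
    Der ((Δ.snoc (A.cl n)).snoc (φ.1.sub fun _ => v0)) (.mem v1 ((A.cl (n + 1)).instAt 2
      (.pair v1 v0))) := by
  rw [instAt, cl_sub]
  exact wk_mem_cl (A.last_mem h) (φ.sub_set (A.last_mem h))

/-- `Der.fst_mem` is about constant families only. The same `split` works here because its target
`A` does not depend on the element being split. -/
theorem Pred.compr_fst {A : ML} (φ : Pred A) {n : ℕ} {Δ : Ctx n} {c : Tm n}
    (hc : Der Δ (.mem c (φ.compr.cl n))) : Der Δ (.mem c.fst (A.cl n)) := by
  rw [Pred.compr_cl] at hc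
  have := Der.split (A.cl_set (.ctx_snoc (φ.compr_cl n ▸ φ.compr.cl_set hc.ctx))) hc
    (φ.compr_body hc.ctx)
  rwa [cl_inst] at this

theorem Pred.compr_pair {A : ML} (φ : Pred A) {n : ℕ} {Δ : Ctx n} {a e : Tm n}
    (ha : Der Δ (.mem a (A.cl n))) (he : Der Δ (.mem e (φ.1.sub fun _ => a))) :
    Der Δ (.mem (.pair a e) (φ.compr.cl n)) ∧
      Der Δ (.eqMem (Tm.pair a e).fst a (A.cl n)) := by
  have hφ := φ.sub_set (A.last_mem ha.ctx)
  have k : (φ.1.sub (fun _ => (v0 : Tm (n + 1)))).inst a = φ.1.sub fun _ => a := Tm.sub_sub _ _ _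
  rw [← k] at he
  rw [Pred.compr_cl]
  refine ⟨.pair hφ ha he, ?_⟩
  have := Der.split_pair (A.cl_set (.ctx_snoc (φ.compr_cl n ▸ φ.compr.cl_set ha.ctx))) ha he
    (φ.compr_body ha.ctx)
  rwa [cl_inst] at this

/-- The projection of a comprehension. -/
def Pred.proj {A : ML} (φ : Pred A) : Term φ.compr A :=
  ⟨Tm.fst v0, by rw [carrier_wk]; exact φ.compr_fst φ.compr.var_mem⟩

/-- This is the dependent second projection, obtained by `split` with the motive `φ(π₁ w)`. -/
theorem Pred.proj_holds {A : ML} (φ : Pred A) :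
    Inh φ.compr.ctx (φ.1.sub fun _ => φ.proj.1) := by
  have hc := φ.compr.var_mem
  have hS := φ.compr.cl_set hc.ctx
  have hC := φ.sub_set (φ.compr_fst (φ.compr.last_mem hc.ctx))
  have hx := A.last_mem hc.ctx
  have hφ := φ.sub_set hx
  rw [Pred.compr_cl] at hc hC
  have hx₂ := wk_mem_cl hx hφ
  have hd : Der ((φ.compr.ctx.snoc (A.cl 1)).snoc (φ.1.sub fun _ => v0))
      (.mem v0 (φ.1.sub fun _ => v1)) := by
    have := hφ.last
    rwa [sub_wk] at this
  have e : (φ.1.sub (fun _ => Tm.fst (v0 : Tm 2))).instAt 2 (.pair v1 v0)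
      = φ.1.sub fun _ => (Tm.pair v1 v0 : Tm 3).fst := Tm.sub_sub _ _ _
  obtain ⟨hp, hq⟩ := φ.compr_pair hx₂ hd
  have hq' : Der _ (.eqMem v1 (Tm.pair v1 v0 : Tm 3).fst (A.cl 3)) := hq.mem_symm
  -- The branch of `split` must prove `φ(π₁ ⟨x, w⟩)`, whereas `w` proves `φ(x)`. The two sets are
  -- convertible, by the computation rule for the first projection.
  have hd₁ := hd.conv (φ.2.subst_set_eq (Δ := (φ.compr.ctx.snoc (A.cl 1)).snoc
      (φ.1.sub fun _ => v0)) (σ := fun _ => v1)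
    (τ := fun _ => (Tm.pair v1 v0 : Tm 3).fst) hd.ctx (by
    rintro (_ | i)
    · simpa only [Ctx.get, carrier_wk, cl_sub] using hq'
    · exact isEmptyElim i))
  have := Der.split (d := v0) hC hc (by exact e ▸ hd₁)
  rw [inst, Tm.sub_sub] at this
  exact ⟨_, this⟩

theorem mem_prod {A B : ML} {n : ℕ} {Δ : Ctx n} {a b : Tm n} (ha : Der Δ (.mem a (A.cl n)))
    (hb : Der Δ (.mem b (B.cl n))) : Der Δ (.mem (.pair a b) ((prod A B).cl n)) := by
  rw [cl, prod, Tm.prod_sub]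
  exact .pair_mem (A.cl_set ha.ctx) (B.cl_set ha.ctx) ha hb

/-- The weak pullback of `f` and `g`, as a predicate on the product. -/
def eqPred {X Y Z : ML} (f : Term X Z) (g : Term Y Z) : Pred (prod X Y) :=
  ⟨.Id (Z.cl 1) ((fstTerm X Y).comp f).1 ((sndTerm X Y).comp g).1, by
    have hf := ((fstTerm X Y).comp f).mem_cl
    exact .id_form (Z.cl_set hf.ctx) hf ((sndTerm X Y).comp g).mem_cl⟩

theorem eqPred_sub {X Y Z : ML} (f : Term X Z) (g : Term Y Z) {n : ℕ} (c : Tm n) :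
    ((eqPred f g).1.sub fun _ => c)
      = .Id (Z.cl n) (f.1.sub fun _ => c.fst) (g.1.sub fun _ => c.snd) := by
  simp only [eqPred, Tm.sub, cl_sub, Term.comp, Tm.sub_sub]
  rfl

/-- Arrows are equal when their terms are propositionally equal, and the second component of an
element of the comprehension is exactly such a proof of identity. -/
theorem eqPred_comm {X Y Z : ML} (f : Term X Z) (g : Term Y Z) :
    ((eqPred f g).proj.comp (fstTerm X Y)).hom ≫ f.hom
      = ((eqPred f g).proj.comp (sndTerm X Y)).hom ≫ g.hom := by
  rw [Term.hom_comp, Term.hom_comp, Term.hom_eq_iff_cl]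
  have := (eqPred f g).proj_holds
  rwa [eqPred_sub] at this

/-! ### Right adjoints and the Beck–Chevalley condition -/

/-- The nontrivial half of the Beck–Chevalley condition, for the weak pullback `eqPred f g`. -/
theorem le_all_of_eqPred {X Y Z : ML} (f : Term X Z) (g : Term Y Z) {γ : Pred Y} {β : Pred X}
    (h : γ.subst ((eqPred f g).proj.comp (sndTerm X Y))
      ≤ β.subst ((eqPred f g).proj.comp (fstTerm X Y))) :
    γ ≤ (Pred.all f β).subst g := by
  rw [Pred.le_iff, Pred.subst_sub]
  obtain ⟨hy, hw⟩ := γ.hyp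
  have hgy := g.sub_mem hy
  have hI := Pred.fibre_id (A := X) f hgy
  -- Beyond `y` and the proof of `γ(y)`, the context now gains `x` and a proof of `f(x) = g(y)`; the
  -- goal becomes `β(x)`.
  refine Pred.all_intro f β hgy ?_
  obtain ⟨hx, -, he⟩ := Pred.fibre_hyp (A := X) f hgy
  have ew : (g.1.sub fun _ => (v1 : Tm 2)).wk.wk = g.1.sub fun _ => v1.wk.wk := by
    rw [Term.sub_wk_const, Term.sub_wk_const]
  rw [ew] at he
  obtain ⟨p, he⟩ := he
  have hy₂ := wk_mem_cl (wk_mem_cl hy hI.ctx_inv.2) hI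
  have hw₂ := Pred.inh_wk (Pred.inh_wk hw hI.ctx_inv.2) hI
  have hX := X.cl_set hx.ctx
  have hY := Y.cl_set hx.ctx
  have hfst := Der.fst_pair hX hY hx hy₂
  have hsnd := Der.snd_pair hX hY hx hy₂
  have hxy := mem_prod hx hy₂
  -- The predicate `eqPred` at `⟨x, y⟩` speaks of `f(π₁ ⟨x, y⟩)` and `g(π₂ ⟨x, y⟩)`, which are
  -- judgementally `f(x)` and `g(y)`.
  have he₁ := he.conv (.id_form_eq (.set_refl (Z.cl_set hx.ctx)) (f.sub_eq hfst.mem_symm)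
    (g.sub_eq hsnd.mem_symm))
  rw [← eqPred_sub] at he₁
  -- The element `⟨⟨x, y⟩, p⟩` of the comprehension is where the hypothesis `h` is applied.
  obtain ⟨hq, hqq⟩ := (eqPred f g).compr_pair hxy he₁
  have h₁ := ((fstTerm X Y).sub_eq hqq).mem_trans hfst
  have h₂ := ((sndTerm X Y).sub_eq hqq).mem_trans hsnd
  have hf₁ := ((eqPred f g).proj.comp (fstTerm X Y)).sub_mem hq
  have hg₁ := ((eqPred f g).proj.comp (sndTerm X Y)).sub_mem hq
  -- The projections of that element are judgementally `x` and `y`. So `γ(y)` passes to its second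
  -- projection, `h` applies, and the conclusion about its first projection is moved to `x`.
  refine β.sub_congr hf₁ hx (IdInh.of_eq hX hf₁ h₁) ?_
  rw [← Pred.subst_sub]
  refine Pred.le_sub h hq ?_
  rw [Pred.subst_sub]
  exact γ.sub_congr hy₂ hg₁ ((IdInh.of_eq hY hg₁ h₂).symm hY hg₁ hy₂) hw₂

/-- The universal property at each single `φ` already yields a Galois connection. Choosing a value
for each class avoids a separate check that `Pred.all` respects equiprovability. -/
theorem exists_rightAdjoint {A B : ML} (f : A ⟶ B) :
    ∃ R : Fib A → Fib B, GaloisConnection (reindex f) R := by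
  obtain ⟨t, rfl⟩ := exists_hom f
  have k : ∀ φ : Fib A, ∃ χ : Fib B, ∀ ψ, reindex t.hom ψ ≤ φ ↔ ψ ≤ χ := by
    intro φ
    induction φ using Quotient.inductionOn with
    | _ φ =>
      refine ⟨toAntisymmetrization _ (Pred.all t φ), fun ψ => ?_⟩
      induction ψ using Quotient.inductionOn with
      | _ ψ => exact Pred.subst_le_iff t ψ φ
  choose R hR using k
  exact ⟨R, fun ψ φ => hR φ ψ⟩

/-- The commutative square on the comprehension of `eqPred` factors through `P`. Reindexing along
the factorization turns a consequence over `P` into one over the comprehension, where it can be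
evaluated at explicit elements. -/
theorem beckChevalley_le {P X Y Z : ML} {h : P ⟶ X} {k : P ⟶ Y} {f : X ⟶ Z} {g : Y ⟶ Z}
    (sq : IsPullback h k f g) {R : Fib X → Fib Z} (hR : GaloisConnection (reindex f) R)
    {γ : Fib Y} {β : Fib X} (hγ : reindex k γ ≤ reindex h β) : γ ≤ reindex g (R β) := by
  obtain ⟨t, rfl⟩ := exists_hom f
  obtain ⟨s, rfl⟩ := exists_hom g
  have hu := OrderHomClass.mono (reindex (sq.lift _ _ (eqPred_comm t s))) hγ
  rw [← reindex_comp, ← reindex_comp, sq.lift_fst, sq.lift_snd] at hu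
  induction γ using Quotient.inductionOn with
  | _ γ => induction β using Quotient.inductionOn with
    | _ β =>
      have h₁ : toAntisymmetrization _ (Pred.all t β) ≤ R (toAntisymmetrization _ β) :=
        -- The given right adjoint `R` is arbitrary. It dominates the explicit quantifier because
        -- the latter satisfies the counit inequality.
        (hR _ _).1 ((Pred.subst_le_iff t _ β).2 le_rfl)
      exact le_trans (show toAntisymmetrization _ γ ≤ reindex s.hom
        (toAntisymmetrization _ (Pred.all t β)) from le_all_of_eqPred t s hu)
        (OrderHomClass.mono (reindex s.hom) h₁)

/-- From left to right, transposing along `k` and using commutativity of the square reduces the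
claim to the counit for `f`, reindexed along `h`. From right to left, the counit for `k` is the
hypothesis of `beckChevalley_le` with `γ = S (reindex h β)`. -/
theorem beckChevalley {P X Y Z : ML} {h : P ⟶ X} {k : P ⟶ Y} {f : X ⟶ Z} {g : Y ⟶ Z}
    (sq : IsPullback h k f g) {R : Fib X → Fib Z} {S : Fib P → Fib Y}
    (hR : GaloisConnection (reindex f) R) (hS : GaloisConnection (reindex k) S) (β : Fib X) :
    reindex g (R β) = S (reindex h β) := by
  refine le_antisymm ((hS _ _).1 ?_) (beckChevalley_le sq hR (hS.l_u_le _))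
  rw [← reindex_comp, ← sq.w, reindex_comp]
  exact OrderHomClass.mono (reindex h) (hR.l_u_le β)

/-! ### Abstraction and weak evaluation -/

theorem piSet_wk (A B : ML) : (piSet A B).carrier.wk = .Pi (A.cl 1) (B.cl 2) := by
  simp only [piSet, wk_eq_sub, Tm.sub, sub_eq_cl, cl_sub]

/-- The abstraction `λ y. t(⟨x, y⟩) ∈ ∏_{y ∈ A} B [x ∈ X]`. -/
def curry {X A B : ML} (t : Term (prod X A) B) : Term X (piSet A B) :=
  ⟨.lam (t.1.sub fun _ => .pair v1 v0), by
    rw [piSet_wk]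
    have hA := A.cl_set X.ctx_der
    exact .lam hA (t.sub_mem (mem_prod (wk_mem_cl X.var_mem hA) (A.last_mem X.ctx_der)))⟩

theorem curry_sub {X A B : ML} (t : Term (prod X A) B) {n : ℕ} (x : Tm n) :
    ((curry t).1.sub fun _ => x) = .lam (t.1.sub fun _ => .pair x.wk v0) := by
  simp only [curry, Tm.sub, Tm.sub_sub]
  rfl

/-- The product of two arrows comes from the universal property, which pairs arbitrarily chosen
representatives. Comparing projections replaces it by an explicit term on which the computation
rules can act. -/
theorem curry_tensor {X A B : ML} (t : Term (prod X A) B) :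
    ((curry t).hom ⊗ₘ 𝟙 A)
      = (pairTerm ((fstTerm X A).comp (curry t)) (sndTerm X A)).hom := by
  have hP := wk_isSet (prod X A) (piSet A B)
  have hA := wk_isSet (prod X A) A
  have hc := ((fstTerm X A).comp (curry t)).2
  have hs := (sndTerm X A).2
  apply CartesianMonoidalCategory.hom_ext
  · rw [tensorHom_fst]
    exact (Term.hom_eq_iff ((fstTerm X A).comp (curry t)) ((pairTerm _ _).comp (fstTerm _ _))).2
      (IdInh.of_eq hP hc (Der.fst_pair hP hA hc hs).mem_symm)
  · rw [tensorHom_snd, Category.comp_id]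
    exact (Term.hom_eq_iff (sndTerm X A) ((pairTerm _ _).comp (sndTerm _ _))).2
      (IdInh.of_eq hA hs (Der.snd_pair hP hA hc hs).mem_symm)

theorem isWeakEvaluation_ev (A B : ML) : IsWeakEvaluation (ev A B) := by
  intro X f
  -- The chosen product `X ⊗ A` is `prod X A` by definition, so `f` has a representing term over it.
  obtain ⟨t, rfl⟩ := exists_hom (A := prod X A) f
  refine ⟨(curry t).hom, ?_⟩
  rw [curry_tensor]
  change t.hom = (Term.comp _ (evTerm A B)).hom
  rw [Term.hom_eq_iff_cl]
  have hz := prod_last X A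
  have hX := wk_isSet (prod X A) X
  have hA := wk_isSet (prod X A) A
  have hB := B.cl_set hA.ctx
  have hP := wk_isSet (prod X A) (piSet A B)
  have hc := ((fstTerm X A).comp (curry t)).2
  have hs := (sndTerm X A).2
  have hx := (fstTerm X A).mem_cl
  have hy := (sndTerm X A).mem_cl
  have hA₁ := A.cl_set hA.ctx
  have hxy := mem_prod hx hy
  -- The `β` rule: the transpose at `π₁ z`, applied to `π₂ z`, is `t(⟨π₁ z, π₂ z⟩)`.
  have hβ := Der.app_lam (t.sub_mem (mem_prod (wk_mem_cl hx hA₁) (A.last_mem hA.ctx))) hy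
  have e : (t.1.sub fun _ => Tm.pair (fstTerm X A).1.wk v0).inst (sndTerm X A).1
      = t.1.sub fun _ => Tm.pair (fstTerm X A).1 (sndTerm X A).1 := by
    rw [inst, Tm.sub_sub]; rfl
  rw [cl_inst, e, ← curry_sub] at hβ
  have cast : ∀ {a b C D : Tm 1}, Der (prod X A).ctx (.eqMem a b C) → C = D →
      Der (prod X A).ctx (.eqMem a b D) := fun h e => e ▸ h
  have hf := cast (Der.fst_pair hP hA hc hs) (piSet_wk A B)
  have ha := cast (Der.snd_pair hP hA hc hs) A.carrier_wk
  -- Evaluation at the pair reduces, by congruence of application and the projection rules, to the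
  -- left-hand side of `hβ`.
  have happ := Der.app_eq (B.cl_set hA₁.ctx_snoc) hf ha
  rw [cl_inst] at happ
  -- The only step that is merely propositional: `z` equals `⟨π₁ z, π₂ z⟩` up to a proof of
  -- identity, hence so do the values of `t` there.
  have hη := IdInh.symm (hX.prod hA) (.pair_mem hX hA (fstTerm X A).2 hs) hz
    (IdInh.pair_eta hX hA hz)
  rw [← prod_wk, carrier_wk] at hη
  have h₁ := t.sub_congr (prod X A).var_mem hxy hη
  rw [sub_const_v0] at h₁
  have ht := t.sub_mem hxy
  exact h₁.trans hB t.mem_cl ht (Term.mem_cl (Term.comp _ (evTerm A B)))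
    (IdInh.of_eq hB ht (happ.mem_trans hβ).mem_symm)

end ML

end MLTT

theorem proposition7p3 :
    -- the evaluations given by dependent products are weak evaluations
    (∀ A B : MLTT.ML, MLTT.IsWeakEvaluation (MLTT.ML.ev A B)) ∧
    MLTT.WeaklyCartesianClosed MLTT.ML ∧
    -- every reindexing has a right adjoint
    (∀ (A B : MLTT.ML) (f : A ⟶ B),
      ∃ R : MLTT.FML.obj (op A) → MLTT.FML.obj (op B),
        GaloisConnection (MLTT.FML.map f.op) R) ∧
    -- right adjoints satisfy the Beck-Chevalley condition
    (∀ (P X Y Z : MLTT.ML) (h : P ⟶ X) (k : P ⟶ Y) (f : X ⟶ Z) (g : Y ⟶ Z),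
      IsPullback h k f g →
      ∀ (R : MLTT.FML.obj (op X) → MLTT.FML.obj (op Z))
        (S : MLTT.FML.obj (op P) → MLTT.FML.obj (op Y)),
        GaloisConnection (MLTT.FML.map f.op) R → GaloisConnection (MLTT.FML.map k.op) S →
        ∀ β : MLTT.FML.obj (op X),
          MLTT.FML.map g.op (R β) = S (MLTT.FML.map h.op β)) :=
  ⟨MLTT.ML.isWeakEvaluation_ev, fun A B => ⟨_, MLTT.ML.ev A B, MLTT.ML.isWeakEvaluation_ev A B⟩,
    fun _ _ f => MLTT.ML.exists_rightAdjoint f,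
    fun _ _ _ _ _ _ _ _ sq _ _ hR hS β => MLTT.ML.beckChevalley sq hR hS β⟩
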